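/- Elliptic regularity. Let $0\le s<r<1$, let $c_0>0$ be a constant, and let $c_1\in H^{r+1}(\mathbb R^2)$ be real-valued with $c_1\ge 0$ almost everywhere; put $c=c_0+c_1$. For $v\in L^2(\mathbb R^2)$ (complex-valued) let $$Av=\operatorname{div}(c\,\nabla v)=\sum_{j=1}^{2}\partial_j\,(c\cdot\partial_j v)$$ in the sense of distributions, where $c\cdot\partial_j v$ is the duality product of $\partial_j v\in H^{-1}(\mathbb R^2)$ with $c$ (for every Schwartz function $\varphi$ one has $\varphi c\in H^1(\mathbb R^2)$), that is, $\langle c\cdot \partial_j v,\varphi\rangle=\langle \partial_j v,\varphi c\rangle_{H^{-1},H^1}$. If $v\in H^s(\mathbb R^2)$ and $Av\in H^s(\mathbb R^2)$, then $v\in H^{s+2}(\mathbb R^2)$. -/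

import Mathlib

open MeasureTheory TemperedDistribution FourierTransform LineDeriv
open scoped SchwartzMap ENNReal

noncomputable section

/-- `w` is the duality product `f · g` of a distribution `g ∈ H⁻¹` with a distribution `f` that
is locally `H¹` in the sense that `φ f ∈ H¹` for every Schwartz function `φ`:
`⟨f · g, φ⟩ = ⟨g, φ f⟩`, where the right-hand side is the canonical (bilinear)
`H⁻¹`-`H¹`-pairing `⟨g, ψ⟩ = ∫ (J⁻¹ g) (J ψ)` given by the Bessel potential `J` of order one. -/
def IsDualityProduct {E : Type*} [NormedAddCommGroup E] [InnerProductSpace ℝ E]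
    [FiniteDimensional ℝ E] [MeasurableSpace E] [BorelSpace E] (f g w : 𝓢'(E, ℂ)) : Prop :=
  ∃ G : Lp ℂ 2 (volume : Measure E), besselPotential E ℂ (-1) g = (G : 𝓢'(E, ℂ)) ∧
    ∀ φ : 𝓢(E, ℂ), ∃ Ψ : Lp ℂ 2 (volume : Measure E),
      besselPotential E ℂ 1 (smulLeftCLM ℂ φ f) = (Ψ : 𝓢'(E, ℂ)) ∧
        w φ = ∫ x, G x * Ψ x

section Existence

variable {E : Type*} [NormedAddCommGroup E] [InnerProductSpace ℝ E]
  [FiniteDimensional ℝ E] [MeasurableSpace E] [BorelSpace E]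

theorem lp_toTD_injective {T S : Lp ℂ 2 (volume : Measure E)}
    (h : (T : 𝓢'(E, ℂ)) = (S : 𝓢'(E, ℂ))) : T = S := by
  have := Lp.ker_toTemperedDistributionCLM_eq_bot (F := ℂ) (μ := (volume : Measure E)) (p := 2)
  exact LinearMap.ker_eq_bot.1 this h

theorem IsDualityProduct.unique {f g w w' : 𝓢'(E, ℂ)} (h : IsDualityProduct f g w)
    (h' : IsDualityProduct f g w') : w = w' := by
  obtain ⟨G, hG, h⟩ := h
  obtain ⟨G', hG', h'⟩ := h'
  obtain rfl : G = G' := lp_toTD_injective (hG.symm.trans hG')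
  ext φ
  obtain ⟨Ψ, hΨ, h⟩ := h φ
  obtain ⟨Ψ', hΨ', h'⟩ := h' φ
  obtain rfl : Ψ = Ψ' := lp_toTD_injective (hΨ.symm.trans hΨ')
  rw [h, h']

theorem integrable_mul_lp (G H : Lp ℂ 2 (volume : Measure E)) :
    Integrable (fun x => G x * H x) := (Lp.memLp G).integrable_mul (Lp.memLp H)

theorem IsDualityProduct.add {f f' g w w' : 𝓢'(E, ℂ)} (h : IsDualityProduct f g w)
    (h' : IsDualityProduct f' g w') : IsDualityProduct (f + f') g (w + w') := by
  obtain ⟨G, hG, h⟩ := h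
  obtain ⟨G', hG', h'⟩ := h'
  obtain rfl : G = G' := lp_toTD_injective (hG.symm.trans hG')
  refine ⟨G, hG, fun φ => ?_⟩
  obtain ⟨Ψ, hΨ, h⟩ := h φ
  obtain ⟨Ψ', hΨ', h'⟩ := h' φ
  refine ⟨Ψ + Ψ', ?_, ?_⟩
  · rw [map_add, map_add, hΨ, hΨ', ← Lp.toTemperedDistributionCLM_apply,
      ← Lp.toTemperedDistributionCLM_apply, ← Lp.toTemperedDistributionCLM_apply, map_add]
  · change w φ + w' φ = _
    rw [h, h', ← integral_add (integrable_mul_lp G Ψ) (integrable_mul_lp G Ψ')]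
    refine integral_congr_ae ?_
    filter_upwards [Lp.coeFn_add Ψ Ψ'] with x hx
    rw [hx, Pi.add_apply, mul_add]

theorem schwartz_multiplier_reflect {m : E → ℂ} (hm : m.HasTemperateGrowth)
    (hm' : (fun x => m (-x)).HasTemperateGrowth) (φ : 𝓢(E, ℂ)) :
    𝓕 (SchwartzMap.smulLeftCLM ℂ m (𝓕⁻ φ)) =
      SchwartzMap.fourierMultiplierCLM ℂ (fun x => m (-x)) φ := by
  rw [SchwartzMap.fourierMultiplierCLM_apply]
  ext x
  rw [SchwartzMap.fourier_coe, SchwartzMap.fourierInv_coe, Real.fourierInv_eq_fourier_comp_neg]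
  refine congrArg (fun h : E → ℂ => 𝓕 h x) (funext fun y => ?_)
  rw [SchwartzMap.smulLeftCLM_apply_apply hm, SchwartzMap.smulLeftCLM_apply_apply hm', neg_neg,
    SchwartzMap.fourier_coe, SchwartzMap.fourierInv_coe, Real.fourierInv_eq_fourier_neg]

theorem exists_multiplier_L2 {m : E → ℂ} (hm : m.HasTemperateGrowth) (hb : ∃ C, ∀ x, ‖m x‖ ≤ C) :
    ∃ B : Lp ℂ 2 (volume : Measure E) →L[ℂ] Lp ℂ 2 (volume : Measure E),
      ∀ h : Lp ℂ 2 (volume : Measure E),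
      fourierMultiplierCLM ℂ m (h : 𝓢'(E, ℂ)) = (B h : 𝓢'(E, ℂ)) := by
  have key : ∀ h : Lp ℂ 2 (volume : Measure E), ∃ h' : Lp ℂ 2 (volume : Measure E),
      fourierMultiplierCLM ℂ m (h : 𝓢'(E, ℂ)) = (h' : 𝓢'(E, ℂ)) := fun h =>
    memSobolev_zero_iff.1 (MemSobolev.fourierMultiplierCLM_of_bounded
      (memSobolev_zero_iff.2 ⟨h, rfl⟩) hm hb)
  choose B hB using key
  let L : Lp ℂ 2 (volume : Measure E) →ₗ[ℂ] Lp ℂ 2 (volume : Measure E) :=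
    { toFun := B
      map_add' := fun x y => by
        apply lp_toTD_injective
        rw [← hB, ← Lp.toTemperedDistributionCLM_apply, ← Lp.toTemperedDistributionCLM_apply,
          map_add, map_add, map_add, Lp.toTemperedDistributionCLM_apply,
          Lp.toTemperedDistributionCLM_apply, Lp.toTemperedDistributionCLM_apply,
          Lp.toTemperedDistributionCLM_apply, hB, hB]
      map_smul' := fun a x => by
        apply lp_toTD_injective
        rw [← hB, ← Lp.toTemperedDistributionCLM_apply, ← Lp.toTemperedDistributionCLM_apply,
          map_smul, map_smul, map_smul, Lp.toTemperedDistributionCLM_apply,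
          Lp.toTemperedDistributionCLM_apply, hB, RingHom.id_apply] }
  refine ⟨⟨L, ?_⟩, hB⟩
  refine LinearMap.continuous_of_isClosed_graph L ?_
  have : (L.graph : Set (Lp ℂ 2 (volume : Measure E) × Lp ℂ 2 (volume : Measure E))) =
      {p | fourierMultiplierCLM ℂ m (Lp.toTemperedDistributionCLM ℂ volume 2 p.1) =
        Lp.toTemperedDistributionCLM ℂ volume 2 p.2} := by
    ext p
    simp only [SetLike.mem_coe, LinearMap.mem_graph_iff, Set.mem_ofPred_eq,
      Lp.toTemperedDistributionCLM_apply]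
    rw [hB]
    exact ⟨fun h => by rw [h]; rfl, fun h => (lp_toTD_injective h).symm⟩
  rw [this]
  exact isClosed_eq (by fun_prop) (by fun_prop)

theorem integral_mul_eq_inner (G H : Lp ℂ 2 (volume : Measure E)) :
    ∫ x, G x * H x = inner ℂ (star G) H := by
  rw [L2.inner_def]
  refine integral_congr_ae ?_
  filter_upwards [Lp.coeFn_star G] with x hx
  rw [hx]
  simp [mul_comm]

theorem multiplier_transpose {m : E → ℂ} (hm : m.HasTemperateGrowth)
    (hm' : (fun x => m (-x)).HasTemperateGrowth)
    (B B' : Lp ℂ 2 (volume : Measure E) →L[ℂ] Lp ℂ 2 (volume : Measure E))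
    (hB : ∀ h : Lp ℂ 2 (volume : Measure E), fourierMultiplierCLM ℂ m (h : 𝓢'(E, ℂ)) = (B h : 𝓢'(E, ℂ)))
    (hB' : ∀ h : Lp ℂ 2 (volume : Measure E),
      fourierMultiplierCLM ℂ (fun x => m (-x)) (h : 𝓢'(E, ℂ)) = (B' h : 𝓢'(E, ℂ)))
    (G H : Lp ℂ 2 (volume : Measure E)) :
    ∫ x, B G x * H x = ∫ x, G x * B' H x := by
  simp only [integral_mul_eq_inner]
  refine DenseRange.induction_on
    (SchwartzMap.denseRange_toLpCLM (p := 2) ENNReal.ofNat_ne_top) H ?_ ?_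
  · exact isClosed_eq (by fun_prop) (by fun_prop)
  intro φ
  rw [SchwartzMap.toLpCLM_apply, ← integral_mul_eq_inner, ← integral_mul_eq_inner]
  have h1 : B' (φ.toLp 2) = (SchwartzMap.fourierMultiplierCLM ℂ (fun x => m (-x)) φ).toLp 2 := by
    apply lp_toTD_injective
    rw [← hB', Lp.toTemperedDistribution_toLp_eq, Lp.toTemperedDistribution_toLp_eq,
      fourierMultiplierCLM_toTemperedDistributionCLM_eq hm']
  rw [h1]
  have h2 := congrArg (fun T : 𝓢'(E, ℂ) => T φ) (hB G)
  simp only [fourierMultiplierCLM_apply_apply, schwartz_multiplier_reflect hm hm',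
    Lp.toTemperedDistribution_apply] at h2
  calc _ = ∫ x, φ x • B G x := by
        refine integral_congr_ae ?_
        filter_upwards [φ.coeFn_toLp 2 volume] with x hx
        rw [hx, smul_eq_mul, mul_comm]
    _ = _ := h2.symm
    _ = _ := by
        refine integral_congr_ae ?_
        filter_upwards [(SchwartzMap.fourierMultiplierCLM ℂ (fun x => m (-x)) φ).coeFn_toLp 2
          volume] with x hx
        rw [hx, smul_eq_mul, mul_comm]

theorem lineDeriv_smulLeft {E : Type*} [NormedAddCommGroup E] [InnerProductSpace ℝ E]
    (φ : 𝓢(E, ℂ)) (f : 𝓢'(E, ℂ)) (e : E) :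
    ∂_{e} (smulLeftCLM ℂ φ f) = smulLeftCLM ℂ φ (∂_{e} f) + smulLeftCLM ℂ (∂_{e} φ : 𝓢(E, ℂ)) f := by
  ext u
  change f _ = f _ + f _
  rw [← map_add]
  congr 1
  ext x
  have h1 : ∀ (ψ η : 𝓢(E, ℂ)) (y : E), SchwartzMap.smulLeftCLM ℂ ψ η y = ψ y * η y :=
    fun ψ η y => by rw [SchwartzMap.smulLeftCLM_apply_apply ψ.hasTemperateGrowth, smul_eq_mul]
  have h2 : ∂_{e} (SchwartzMap.smulLeftCLM ℂ φ u) x = ∂_{e} φ x * u x + φ x * ∂_{e} u x := by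
    simp only [SchwartzMap.lineDerivOp_apply_eq_fderiv]
    have h3 : (SchwartzMap.smulLeftCLM ℂ φ u : E → ℂ) = fun y => φ y * u y := funext (h1 φ u)
    rw [h3, fderiv_fun_mul φ.differentiableAt u.differentiableAt]
    simp only [add_apply, smul_apply, smul_eq_mul]
    ring
  change SchwartzMap.smulLeftCLM ℂ φ (-∂_{e} u) x = -(∂_{e} (SchwartzMap.smulLeftCLM ℂ φ u) x)
    + SchwartzMap.smulLeftCLM ℂ (∂_{e} φ : 𝓢(E, ℂ)) u x
  rw [h1, h1, h2, neg_apply]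
  ring

/-- `J = J⁻¹ + (2πi)⁻¹ ∑ⱼ ρⱼ(D) ∂ⱼ` where `ρⱼ(ξ) = ξⱼ (1 + |ξ|²)^(-1/2)`. -/
theorem bessel_one_decomp {ι : Type*} [Fintype ι] (b : OrthonormalBasis ι ℝ E) (u : 𝓢'(E, ℂ)) :
    besselPotential E ℂ 1 u = besselPotential E ℂ (-1) u + (2 * Real.pi * Complex.I)⁻¹ •
      ∑ j, fourierMultiplierCLM ℂ
        (fun x => Complex.ofReal (inner ℝ x (b j) * (1 + ‖x‖ ^ 2) ^ (-1 / 2 : ℝ))) (∂_{b j} u) := by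
  have h1 : ∀ j, fourierMultiplierCLM ℂ
        (fun x => Complex.ofReal (inner ℝ x (b j) * (1 + ‖x‖ ^ 2) ^ (-1 / 2 : ℝ))) (∂_{b j} u) =
      (2 * Real.pi * Complex.I) • fourierMultiplierCLM ℂ (fun x => Complex.ofReal
        (inner ℝ x (b j) ^ 2 * (1 + ‖x‖ ^ 2) ^ (-1 / 2 : ℝ))) u := by
    intro j
    rw [lineDeriv_eq_fourierMultiplierCLM, map_smul,
      fourierMultiplierCLM_fourierMultiplierCLM_apply (by fun_prop) (by fun_prop)]
    congr 3
    funext x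
    simp only [Pi.mul_apply]
    push_cast
    ring
  simp_rw [h1]
  rw [← Finset.smul_sum, smul_smul, inv_mul_cancel₀ (by simp [Real.pi_ne_zero]), one_smul,
    besselPotential, besselPotential, ← sum_apply, ← fourierMultiplierCLM_sum ℂ (by fun_prop)]
  have h2 : fourierMultiplierCLM ℂ (fun x : E => Complex.ofReal ((1 + ‖x‖ ^ 2) ^ ((1 : ℝ) / 2))) =
      fourierMultiplierCLM ℂ (fun x : E => Complex.ofReal ((1 + ‖x‖ ^ 2) ^ ((-1 : ℝ) / 2))) +
      fourierMultiplierCLM ℂ (fun x : E => ∑ j, Complex.ofReal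
        (inner ℝ x (b j) ^ 2 * (1 + ‖x‖ ^ 2) ^ (-1 / 2 : ℝ))) := by
    ext v w
    simp only [add_apply, fourierMultiplierCLM_apply_apply]
    change _ = v _ + v _
    rw [← map_add]
    congr 1
    rw [← FourierTransform.fourier_add, ← add_apply,
      ← SchwartzMap.smulLeftCLM_add (by fun_prop) (by fun_prop)]
    congr 3
    funext x
    simp only [Pi.add_apply]
    rw [← Complex.ofReal_sum, ← Complex.ofReal_add]
    refine congrArg Complex.ofReal ?_
    rw [← Finset.sum_mul, b.sum_sq_inner_left]
    have hp : (0 : ℝ) < 1 + ‖x‖ ^ 2 := by positivity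
    calc (1 + ‖x‖ ^ 2) ^ ((1 : ℝ) / 2) =
          (1 + ‖x‖ ^ 2) ^ (1 : ℝ) * (1 + ‖x‖ ^ 2) ^ (-1 / 2 : ℝ) := by
            rw [← Real.rpow_add hp]
            norm_num
      _ = _ := by
            rw [Real.rpow_one]
            ring
  rw [h2]
  rfl

theorem isDualityProduct_const (a : ℂ) {g : 𝓢'(E, ℂ)} (hg : MemSobolev (-1) 2 g) :
    IsDualityProduct (a • (volume : Measure E).toTemperedDistribution) g (a • g) := by
  obtain ⟨G, hG⟩ := hg
  refine ⟨G, hG, fun φ => ?_⟩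
  have hm : (fun x : E => Complex.ofReal ((1 + ‖x‖ ^ 2) ^ ((1 : ℝ) / 2))).HasTemperateGrowth := by
    fun_prop
  let Jφ := SchwartzMap.fourierMultiplierCLM ℂ
    (fun x : E => Complex.ofReal ((1 + ‖x‖ ^ 2) ^ ((1 : ℝ) / 2))) φ
  refine ⟨a • Jφ.toLp 2 volume, ?_, ?_⟩
  · have : smulLeftCLM ℂ φ (a • (volume : Measure E).toTemperedDistribution) =
        a • (φ : 𝓢'(E, ℂ)) := by
      ext u
      change a • (volume : Measure E).toTemperedDistribution (SchwartzMap.smulLeftCLM ℂ φ u) = a • _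
      congr 1
      refine Eq.trans ?_ (SchwartzMap.toTemperedDistributionCLM_apply_apply (μ := volume) φ u).symm
      rw [Measure.toTemperedDistribution_apply volume]
      simp [SchwartzMap.smulLeftCLM_apply_apply φ.hasTemperateGrowth, mul_comm]
    rw [this, map_smul, besselPotential, fourierMultiplierCLM_toTemperedDistributionCLM_eq hm,
      ← Lp.toTemperedDistributionCLM_apply, map_smul, Lp.toTemperedDistributionCLM_apply,
      Lp.toTemperedDistribution_toLp_eq]
  · have h1 : g = besselPotential E ℂ 1 (G : 𝓢'(E, ℂ)) :=
      ((besselPotential_neg_apply_eq_iff 1 g _).1 hG).symm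
    have h2 : g φ = ∫ x, Jφ x • G x := by
      rw [h1, besselPotential, fourierMultiplierCLM_apply_apply,
        schwartz_multiplier_reflect hm (by simpa only [norm_neg] using hm),
        Lp.toTemperedDistribution_apply]
      simp only [norm_neg]
      rfl
    change a • g φ = _
    rw [h2, ← integral_smul]
    refine integral_congr_ae ?_
    filter_upwards [Lp.coeFn_smul a (Jφ.toLp 2 volume), Jφ.coeFn_toLp 2 volume] with x hx hx'
    rw [hx, Pi.smul_apply, hx']
    simp only [smul_eq_mul]
    ring

theorem exists_isDualityProduct {f g : 𝓢'(E, ℂ)} (hf : MemSobolev 1 2 f)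
    (hg : MemSobolev (-1) 2 g) : ∃ w, IsDualityProduct f g w := by
  let b := stdOrthonormalBasis ℝ E
  obtain ⟨G, hG⟩ := hg
  obtain ⟨f₀, hf₀⟩ := memSobolev_zero_iff.1 (hf.mono zero_le_one)
  have hf₁ : ∀ j, ∃ h : Lp ℂ 2 (volume : Measure E), ∂_{b j} f = (h : 𝓢'(E, ℂ)) := fun j =>
    memSobolev_zero_iff.1 (by simpa using hf.lineDerivOp (m := b j))
  choose f₁ hf₁ using hf₁
  -- the bounded multipliers
  have hm0 : (fun x : E => Complex.ofReal ((1 + ‖x‖ ^ 2) ^ ((-1 : ℝ) / 2))).HasTemperateGrowth := by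
    fun_prop
  have hle : ∀ x : E, (1 + ‖x‖ ^ 2) ^ ((-1 : ℝ) / 2) ≤ 1 := fun x =>
    Real.rpow_le_one_of_one_le_of_nonpos (by simp) (by norm_num)
  obtain ⟨B, hB⟩ := exists_multiplier_L2 hm0 ⟨1, fun x => by
    rw [Complex.norm_real, Real.norm_eq_abs, abs_of_nonneg (by positivity)]
    exact hle x⟩
  let ρ : Fin (Module.finrank ℝ E) → E → ℂ := fun j x =>
    Complex.ofReal (inner ℝ x (b j) * (1 + ‖x‖ ^ 2) ^ (-1 / 2 : ℝ))
  have hρ : ∀ j, (ρ j).HasTemperateGrowth := fun j => by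
    simp only [ρ]
    fun_prop
  have hρb : ∀ j, ∃ C, ∀ x, ‖ρ j x‖ ≤ C := fun j => ⟨1, fun x => by
    simp only [ρ]
    rw [Complex.norm_real, Real.norm_eq_abs, abs_mul]
    have hp : (0 : ℝ) < 1 + ‖x‖ ^ 2 := by positivity
    have h1 : |inner ℝ x (b j)| ≤ (1 + ‖x‖ ^ 2) ^ (1 / 2 : ℝ) := by
      refine (abs_real_inner_le_norm x (b j)).trans ?_
      rw [b.orthonormal.1 j, mul_one, ← Real.sqrt_eq_rpow]
      exact Real.le_sqrt_of_sq_le (by linarith)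
    rw [abs_of_nonneg (a := (1 + ‖x‖ ^ 2) ^ (-1 / 2 : ℝ)) (by positivity)]
    calc _ ≤ (1 + ‖x‖ ^ 2) ^ (1 / 2 : ℝ) * (1 + ‖x‖ ^ 2) ^ (-1 / 2 : ℝ) := by gcongr
      _ = 1 := by
        rw [← Real.rpow_add hp]
        norm_num⟩
  choose R hR using fun j => exists_multiplier_L2 (hρ j) (hρb j)
  have hBt : ∀ H K : Lp ℂ 2 (volume : Measure E), ∫ x, B H x * K x = ∫ x, H x * B K x :=
    multiplier_transpose hm0 (by simpa only [norm_neg] using hm0) B B hB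
      (by simpa only [norm_neg] using hB)
  have hρn : ∀ j, (fun x => ρ j (-x)) = (-1 : ℂ) • ρ j := fun j => by
    funext x
    simp [ρ]
  have hRt : ∀ j, ∀ H K : Lp ℂ 2 (volume : Measure E),
      ∫ x, R j H x * K x = ∫ x, H x * ((-1 : ℂ) • R j) K x := fun j =>
    multiplier_transpose (hρ j) (by rw [hρn]; simpa using (hρ j).neg) (R j) ((-1 : ℂ) • R j) (hR j)
      (fun h => by
        rw [hρn, fourierMultiplierCLM_smul (hρ j), smul_apply, hR, smul_apply,
          ← Lp.toTemperedDistributionCLM_apply, ← Lp.toTemperedDistributionCLM_apply, map_smul])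
  -- products of square integrable functions
  let P : Lp ℂ 2 (volume : Measure E) → Lp ℂ 2 (volume : Measure E) → 𝓢'(E, ℂ) := fun H K =>
    ((memLp_one_iff_integrable.2 (integrable_mul_lp H K)).toLp _ : Lp ℂ 1 (volume : Measure E))
  have hP : ∀ H K (φ : 𝓢(E, ℂ)), P H K φ = ∫ x, H x * (φ x * K x) := fun H K φ => by
    simp only [P, Lp.toTemperedDistribution_apply]
    refine integral_congr_ae ?_
    filter_upwards [(memLp_one_iff_integrable.2 (integrable_mul_lp H K)).coeFn_toLp] with x hx
    rw [hx, smul_eq_mul]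
    ring
  -- multiplication by a Schwartz function on square integrable functions
  let M : 𝓢(E, ℂ) → Lp ℂ 2 (volume : Measure E) → Lp ℂ 2 (volume : Measure E) := fun φ K =>
    (φ.memLp ⊤ volume).toLp _ • K
  have hM : ∀ (φ : 𝓢(E, ℂ)) (K : Lp ℂ 2 (volume : Measure E)), smulLeftCLM ℂ φ (K : 𝓢'(E, ℂ)) = (M φ K : 𝓢'(E, ℂ)) := fun φ K =>
    (Lp.toTemperedDistribution_smul_eq φ.hasTemperateGrowth (φ.memLp ⊤ volume) K).symm
  have hM' : ∀ H K (φ : 𝓢(E, ℂ)), P H K φ = ∫ x, H x * M φ K x := fun H K φ => by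
    rw [hP]
    refine integral_congr_ae ?_
    filter_upwards [Lp.coeFn_lpSMul (r := 2) ((φ.memLp ⊤ volume).toLp _) K,
      (φ.memLp ⊤ volume).coeFn_toLp] with x hx hx'
    simp only [M]
    rw [hx, Pi.smul_apply', hx', smul_eq_mul]
  let c : ℂ := (2 * Real.pi * Complex.I)⁻¹
  refine ⟨P (B G) f₀ + (-c) • ∑ j, (P (R j G) (f₁ j) - ∂_{b j} (P (R j G) f₀)), G, hG,
    fun φ => ?_⟩
  let U : Fin (Module.finrank ℝ E) → Lp ℂ 2 (volume : Measure E) := fun j =>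
    M φ (f₁ j) + M (∂_{b j} φ : 𝓢(E, ℂ)) f₀
  have hU : ∀ j, ∂_{b j} (smulLeftCLM ℂ φ f) = (U j : 𝓢'(E, ℂ)) := fun j => by
    rw [lineDeriv_smulLeft, hf₁, hf₀, hM, hM]
    simp only [U]
    rw [← Lp.toTemperedDistributionCLM_apply, ← Lp.toTemperedDistributionCLM_apply,
      ← Lp.toTemperedDistributionCLM_apply, map_add]
  refine ⟨B (M φ f₀) + c • ∑ j, R j (U j), ?_, ?_⟩
  · rw [bessel_one_decomp b]
    simp_rw [hU]
    rw [hf₀, hM, besselPotential, hB, ← Lp.toTemperedDistributionCLM_apply,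
      ← Lp.toTemperedDistributionCLM_apply, map_add, map_smul, map_sum]
    simp only [Lp.toTemperedDistributionCLM_apply]
    congr 2
    exact Finset.sum_congr rfl fun j _ => hR j (U j)
  · have hD : ∀ j, (P (R j G) (f₁ j) - ∂_{b j} (P (R j G) f₀)) φ =
        -∫ x, G x * R j (U j) x := fun j => by
      have e1 : (P (R j G) (f₁ j) - ∂_{b j} (P (R j G) f₀)) φ =
          P (R j G) (f₁ j) φ + P (R j G) f₀ (∂_{b j} φ) := by
        change P (R j G) (f₁ j) φ - P (R j G) f₀ (-∂_{b j} φ) = _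
        rw [map_neg, sub_neg_eq_add]
      have e2 : P (R j G) (f₁ j) φ + P (R j G) f₀ (∂_{b j} φ) = ∫ x, R j G x * U j x := by
        rw [hM', hM', ← integral_add (integrable_mul_lp _ _) (integrable_mul_lp _ _)]
        refine integral_congr_ae ?_
        filter_upwards [Lp.coeFn_add (M φ (f₁ j)) (M (∂_{b j} φ : 𝓢(E, ℂ)) f₀)] with x hx
        simp only [U]
        rw [hx, Pi.add_apply, mul_add]
      rw [e1, e2, hRt, ← integral_neg]
      refine integral_congr_ae ?_
      filter_upwards [Lp.coeFn_smul (-1 : ℂ) (R j (U j))] with x hx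
      rw [smul_apply, hx]
      simp
    have hw : (P (B G) f₀ + (-c) • ∑ j, (P (R j G) (f₁ j) - ∂_{b j} (P (R j G) f₀))) φ =
        (∫ x, G x * B (M φ f₀) x) + c * ∑ j, ∫ x, G x * R j (U j) x := by
      change P (B G) f₀ φ +
        (-c) • (∑ j, (P (R j G) (f₁ j) - ∂_{b j} (P (R j G) f₀))) φ = _
      rw [sum_apply]
      simp only [hD]
      rw [hM', hBt, Finset.sum_neg_distrib]
      simp
    rw [hw]
    simp only [integral_mul_eq_inner]
    rw [inner_add_right, inner_smul_right, inner_sum]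

end Existence

/-- The duality product `f · g`; it is defined for every `g ∈ H⁻¹` and every `f` which is the sum of
a constant and an element of `H¹`, see `isDualityProduct_dualityProduct`.
(The value is `0` where the product does not exist.) -/
def dualityProduct {E : Type*} [NormedAddCommGroup E] [InnerProductSpace ℝ E]
    [FiniteDimensional ℝ E] [MeasurableSpace E] [BorelSpace E] (f g : 𝓢'(E, ℂ)) : 𝓢'(E, ℂ) :=
  open Classical in if h : ∃ w, IsDualityProduct f g w then h.choose else 0

theorem isDualityProduct_dualityProduct {E : Type*} [NormedAddCommGroup E] [InnerProductSpace ℝ E]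
    [FiniteDimensional ℝ E] [MeasurableSpace E] [BorelSpace E] (a : ℂ) {f g : 𝓢'(E, ℂ)}
    (hf : MemSobolev 1 2 f) (hg : MemSobolev (-1) 2 g) :
    IsDualityProduct (a • (volume : Measure E).toTemperedDistribution + f) g
      (dualityProduct (a • (volume : Measure E).toTemperedDistribution + f) g) := by
  obtain ⟨w, hw⟩ := exists_isDualityProduct hf hg
  have h : ∃ w, IsDualityProduct (a • (volume : Measure E).toTemperedDistribution + f) g w :=
    ⟨_, (isDualityProduct_const a hg).add hw⟩
  rw [dualityProduct, dif_pos h]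
  exact h.choose_spec

/-- The function `c₀ + c₁`, with a constant `c₀` and a square integrable `c₁`, as a tempered
distribution. -/
def coeffDistribution {E : Type*} [NormedAddCommGroup E] [InnerProductSpace ℝ E]
    [FiniteDimensional ℝ E] [MeasurableSpace E] [BorelSpace E] (c₀ : ℝ)
    (c₁ : Lp ℂ 2 (volume : Measure E)) : 𝓢'(E, ℂ) :=
  (c₀ : ℂ) • (volume : Measure E).toTemperedDistribution + Lp.toTemperedDistribution c₁

theorem coeffDistribution_apply {E : Type*} [NormedAddCommGroup E] [InnerProductSpace ℝ E]
    [FiniteDimensional ℝ E] [MeasurableSpace E] [BorelSpace E] (c₀ : ℝ)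
    (c₁ : Lp ℂ 2 (volume : Measure E)) (φ : 𝓢(E, ℂ)) :
    coeffDistribution c₀ c₁ φ = ∫ x, φ x * (c₀ + c₁ x) := by
  have h1 : Integrable (fun x => φ x * (c₁ x : ℂ)) :=
    (φ.memLp 2 volume).integrable_mul (Lp.memLp c₁)
  have h2 : Integrable (fun x => φ x * (c₀ : ℂ)) := φ.integrable.mul_const _
  simp only [mul_add]
  rw [integral_add h2 h1, integral_mul_const, mul_comm _ (c₀ : ℂ)]
  change (c₀ : ℂ) • (volume : Measure E).toTemperedDistribution φ +
    Lp.toTemperedDistribution c₁ φ = _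
  rw [Measure.toTemperedDistribution_apply volume, Lp.toTemperedDistribution_apply]
  simp only [smul_eq_mul]

/-- The operator `v ↦ div (c grad v)` on the plane, in the sense of distributions. -/
def divGrad (c v : 𝓢'(EuclideanSpace ℝ (Fin 2), ℂ)) : 𝓢'(EuclideanSpace ℝ (Fin 2), ℂ) :=
  ∑ j : Fin 2, ∂_{EuclideanSpace.single j (1 : ℝ)}
    (dualityProduct c (∂_{EuclideanSpace.single j (1 : ℝ)} v))

end

/-! ### Real inequalities behind the commutator estimate. -/

section Weights

/-! Let `V`, `k`, `F` be the Fourier transforms of `v`, `c₁`, `Av`, and write `⟨x⟩` for `(1 +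
|x|²)^(1/2)`. The equation becomes `c₀|x|² V(x) + ∫ k(x - y) (x·y) V(y) dy = -F(x)/(4π²)`
(`ae_equation_of_fourier_div_grad`), and Sobolev regularity becomes a weighted `L²` bound on `V`
(`memSobolev_iff_l2Norm_ne_top`).

The proof is an energy estimate. Multiply by `W(x)² conj V(x)` and integrate, where `W` is a weight
of order `p + α`. If `W(x)²` is replaced by `W(x)W(y)` in the double integral, that integral becomes
a sum over coordinates of quadratic forms with kernel `k(x - y)`. Since `c₁ ≥ 0`, these are
nonnegative (`integral_conj_mul_kernel_nonneg`) and can be dropped, so no smallness of `c₁` is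
needed and `c₀ > 0` alone controls `‖W|x|V‖²`.

The price is the commutator `W(x)(W(x) - W(y))`. Its second factor is at most a constant times
`(⟨x⟩^(-β) + ⟨y⟩^(-β) + ⟨x-y⟩^(-β)) ⟨x-y⟩^(α+β) ⟨y⟩^p` (`commutator_weight_bound`). With `α + β = r
+ 1` the power of `⟨x-y⟩` is what `c₁ ∈ H^(r+1)` pays for. In dimension at most two, `β > 1` makes
`⟨·⟩^(-β)` square integrable, and Cauchy-Schwarz closes the trilinear estimate
(`lintegral_trilinear_weight_le`). Here `V` is needed only with weight `⟨y⟩^(p+1)`, so `α`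
derivatives are gained.

To have finite quantities throughout, `W` is truncated at height `R`; the bounds are uniform in `R`,
and Fatou's lemma removes the truncation. Since `β > 1` forces `α < r`, a single step gains less
than two derivatives; `α = 2/N` is iterated `N` times. -/

theorem rpow_le_two_rpow_abs {x : ℝ} (q : ℝ) (h1 : 1 / 2 ≤ x) (h2 : x ≤ 2) : x ^ q ≤ 2 ^ |q| := by
  have hx : 0 < x := by linarith
  rcases le_total 0 q with hq | hq
  · rw [abs_of_nonneg hq]
    exact Real.rpow_le_rpow hx.le h2 hq
  · rw [abs_of_nonpos hq]
    have : x ^ q ≤ (1 / 2 : ℝ) ^ q := Real.rpow_le_rpow_of_nonpos (by norm_num) h1 hq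
    refine this.trans_eq ?_
    rw [one_div, Real.inv_rpow (by norm_num), Real.rpow_neg (by norm_num)]

/-- Mean value inequality on `[1/2, 2]`, where the derivative `p y^(p-1)` is at most `|p| 2^|p-1|`
in absolute value. -/
theorem abs_rpow_sub_one_le (p : ℝ) {x : ℝ} (h1 : 1 / 2 ≤ x) (h2 : x ≤ 2) :
    |x ^ p - 1| ≤ |p| * 2 ^ |p - 1| * |x - 1| := by
  have := (convex_Icc (1 / 2 : ℝ) 2).norm_image_sub_le_of_norm_hasDerivWithin_le
    (f := fun y => y ^ p) (f' := fun y => p * y ^ (p - 1)) (C := |p| * 2 ^ |p - 1|) (x := 1) (y := x)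
    (fun y hy => (Real.hasDerivAt_rpow_const (Or.inl (by
      have := hy.1; intro h; rw [h] at this; norm_num at this))).hasDerivWithinAt)
    (fun y hy => by
      have hy0 : 0 ≤ y := by have := hy.1; linarith
      rw [norm_mul, Real.norm_eq_abs, Real.norm_eq_abs, abs_of_nonneg (Real.rpow_nonneg hy0 _)]
      gcongr
      exact rpow_le_two_rpow_abs _ hy.1 hy.2)
    ⟨by norm_num, by norm_num⟩ ⟨h1, h2⟩
  simpa using this

/-- Truncation is 1-Lipschitz, and `t ↦ t^α` is subadditive for `0 ≤ α ≤ 1`, hence Hölder with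
constant 1. The bound therefore does not see `R`. -/
theorem abs_min_rpow_sub_le {α a b d R : ℝ} (hα0 : 0 ≤ α) (hα1 : α ≤ 1) (ha : 0 ≤ a) (hb : 0 ≤ b)
    (hR : 0 ≤ R) (hab : |a - b| ≤ d) : |min a R ^ α - min b R ^ α| ≤ d ^ α := by
  have key : ∀ x y : ℝ, 0 ≤ x → 0 ≤ y → |x - y| ≤ d → x ^ α - y ^ α ≤ d ^ α := fun x y hx hy h => by
    have hd : 0 ≤ d := (abs_nonneg _).trans h
    have h1 : x ≤ y + d := by linarith [le_abs_self (x - y)]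
    have h2 := Real.rpow_le_rpow hx h1 hα0
    have h3 := Real.rpow_add_le_add_rpow hy hd hα0 hα1
    linarith
  have h : |min a R - min b R| ≤ d := by
    refine le_trans ?_ hab
    simpa using abs_min_sub_min_le_max a R b R
  rw [abs_le]
  constructor
  · have := key _ _ (le_min hb hR) (le_min ha hR) (by rwa [abs_sub_comm])
    linarith
  · exact key _ _ (le_min ha hR) (le_min hb hR) h

/-- The variables stand for `a = ⟨x⟩`, `b = ⟨y⟩`, `d = ⟨x-y⟩`; what matters is that `C` does not
depend on `R`. Near the diagonal (`d ≤ b/2`) the ratio `a/b` stays in `[1/2, 2]` and the difference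
is `O(d^α b^p)`, which the term `d^(-β)` covers. Away from it `a` and `b` are both `O(d)`, and the
possibly large factor `(a/b)^p` is absorbed by `a^(-β)` or `b^(-β)`; this is where `|p| ≤ β` enters.
-/
theorem commutator_weight_bound {α β p : ℝ} (hα0 : 0 ≤ α) (hα1 : α ≤ 1) (hp : -β ≤ p) (hpβ : p ≤ β) :
    ∃ C : ℝ, 0 ≤ C ∧ ∀ a b d R : ℝ, 1 ≤ a → 1 ≤ b → 1 ≤ d → 1 ≤ R → |a - b| ≤ d →
      |a ^ p * min a R ^ α - b ^ p * min b R ^ α| ≤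
        C * (a ^ (-β) + b ^ (-β) + d ^ (-β)) * d ^ (α + β) * b ^ p := by
  obtain ⟨C₁, hC₁, h₁⟩ : ∃ C : ℝ, 0 ≤ C ∧ ∀ x : ℝ, 1 / 2 ≤ x → x ≤ 2 → |x ^ p - 1| ≤ C * |x - 1| :=
    ⟨_, by positivity, fun x => abs_rpow_sub_one_le p⟩
  -- `2^|p| + C₁` serves the region near the diagonal, the remaining terms the region `b < 2d`.
  refine ⟨2 ^ |p| + C₁ + 2 ^ α + (1 + 2 ^ α) * (3 ^ |p| * 2 ^ |p - β| + 2 ^ |p| * 3 ^ |p + β|),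
    by positivity, fun a b d R ha hb hd hR hab => ?_⟩
  have ha0 : 0 < a := by linarith
  have hb0 : 0 < b := by linarith
  have hd0 : 0 < d := by linarith
  have hm := abs_min_rpow_sub_le hα0 hα1 ha0.le hb0.le (by linarith : (0 : ℝ) ≤ R) hab
  have hmb : min b R ^ α ≤ b ^ α :=
    Real.rpow_le_rpow (le_min hb0.le (by linarith)) (min_le_left _ _) hα0
  have hmb0 : 0 ≤ min b R ^ α := Real.rpow_nonneg (le_min hb0.le (by linarith)) _
  have hapb : a ^ p = (a / b) ^ p * b ^ p := by
    rw [Real.div_rpow ha0.le hb0.le, div_mul_cancel₀ _ (Real.rpow_pos_of_pos hb0 _).ne']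
  have e1 : |a ^ p * min a R ^ α - b ^ p * min b R ^ α| ≤
      ((a / b) ^ p * d ^ α + |(a / b) ^ p - 1| * b ^ α) * b ^ p := by
    have : a ^ p * min a R ^ α - b ^ p * min b R ^ α = ((a / b) ^ p * (min a R ^ α - min b R ^ α) +
        ((a / b) ^ p - 1) * min b R ^ α) * b ^ p := by rw [hapb]; ring
    rw [this, abs_mul, abs_of_pos (Real.rpow_pos_of_pos hb0 p)]
    gcongr
    refine (abs_add_le _ _).trans ?_
    rw [abs_mul, abs_mul, abs_of_nonneg hmb0, abs_of_pos (Real.rpow_pos_of_pos (div_pos ha0 hb0) p)]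
    gcongr
  refine e1.trans ?_
  gcongr
  set Q := (a / b) ^ p with hQ
  have hQ0 : 0 < Q := Real.rpow_pos_of_pos (div_pos ha0 hb0) p
  have hdd : d ^ (-β) * d ^ (α + β) = d ^ α := by rw [← Real.rpow_add hd0]; ring_nf
  have hA : 0 < a ^ (-β) := Real.rpow_pos_of_pos ha0 _
  have hB : 0 < b ^ (-β) := Real.rpow_pos_of_pos hb0 _
  have hD : 0 < d ^ (-β) := Real.rpow_pos_of_pos hd0 _
  have hDa : 0 < d ^ (α + β) := Real.rpow_pos_of_pos hd0 _
  have hDα : 0 < d ^ α := Real.rpow_pos_of_pos hd0 _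
  have h2α : (0 : ℝ) < 2 ^ α := Real.rpow_pos_of_pos two_pos _
  set S₁ : ℝ := 2 ^ |p| with hS₁
  set S₂ : ℝ := 3 ^ |p| * 2 ^ |p - β| + 2 ^ |p| * 3 ^ |p + β| with hS₂
  have hS₁0 : 0 < S₁ := by positivity
  have hS₂0 : 0 < S₂ := by positivity
  rcases le_or_gt d (b / 2) with h | h
  · have hab' := abs_le.1 hab
    have hx1 : 1 / 2 ≤ a / b := by rw [le_div_iff₀ hb0]; linarith
    have hx2 : a / b ≤ 2 := by rw [div_le_iff₀ hb0]; linarith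
    have hq : Q ≤ S₁ := rpow_le_two_rpow_abs p hx1 hx2
    have hdb : |Q - 1| * b ^ α ≤ C₁ * d ^ α := by
      have t1 : |a / b - 1| ≤ d / b := by
        rw [div_sub_one hb0.ne', abs_div, abs_of_pos hb0]
        gcongr
      have t2 : d / b * b ^ α ≤ d ^ α := by
        have : (d / b) ^ (1 : ℝ) ≤ (d / b) ^ α :=
          Real.rpow_le_rpow_of_exponent_ge (by positivity) (by rw [div_le_one hb0]; linarith) hα1
        rw [Real.rpow_one] at this
        calc _ ≤ (d / b) ^ α * b ^ α := by gcongr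
          _ = _ := by rw [Real.div_rpow hd0.le hb0.le, div_mul_cancel₀ _ (by positivity)]
      calc _ ≤ C₁ * |a / b - 1| * b ^ α := by gcongr; exact h₁ _ hx1 hx2
        _ ≤ C₁ * (d / b) * b ^ α := by gcongr
        _ = C₁ * (d / b * b ^ α) := by ring
        _ ≤ _ := by gcongr
    calc _ ≤ S₁ * d ^ α + C₁ * d ^ α := by gcongr
      -- The zeros hold the places of the terms of the constant and of the weight not needed here,
      -- so that monotonicity can be applied term by term.
      _ = (S₁ + C₁ + 0 + 0) * (0 + 0 + d ^ (-β)) * d ^ (α + β) := by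
        rw [← hdd]; ring
      _ ≤ _ := by gcongr; positivity
  · have hb2 : b ≤ 2 * d := by linarith
    have ha3 : a ≤ 3 * d := by have := abs_le.1 hab; linarith
    have hbα : b ^ α ≤ 2 ^ α * d ^ α := by
      rw [← Real.mul_rpow (by norm_num) hd0.le]
      exact Real.rpow_le_rpow hb0.le hb2 hα0
    have hQ1 : |Q - 1| ≤ Q + 1 := by
      rw [abs_le]; constructor <;> linarith
    -- For `p ≥ 0`, `a^p ≲ d^p` and `p - β ≤ 0` let `d^(p-β)` be traded for `b^(p-β)`. For `p ≤ 0`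
    -- the roles of `a` and `b` are exchanged and `-p - β ≤ 0` is used.
    have hQd : Q * d ^ (-β) ≤ S₂ * (a ^ (-β) + b ^ (-β)) := by
      rcases le_total 0 p with hp0 | hp0
      · have u1 : a ^ p ≤ 3 ^ |p| * d ^ p := by
          rw [abs_of_nonneg hp0, ← Real.mul_rpow (by norm_num) hd0.le]
          exact Real.rpow_le_rpow ha0.le ha3 hp0
        have u2 : d ^ (p - β) ≤ 2 ^ |p - β| * b ^ (p - β) := by
          rw [abs_of_nonpos (by linarith), Real.rpow_neg (by norm_num), ← Real.inv_rpow (by norm_num),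
            ← Real.mul_rpow (by norm_num) hb0.le]
          exact Real.rpow_le_rpow_of_nonpos (by positivity) (by linarith) (by linarith)
        calc Q * d ^ (-β) = a ^ p * b ^ (-p) * d ^ (-β) := by
              rw [hQ, Real.div_rpow ha0.le hb0.le, Real.rpow_neg hb0.le p]; ring
          _ ≤ (3 ^ |p| * d ^ p) * b ^ (-p) * d ^ (-β) := by gcongr
          _ = 3 ^ |p| * b ^ (-p) * d ^ (p - β) := by
              rw [sub_eq_add_neg, Real.rpow_add hd0]; ring
          _ ≤ 3 ^ |p| * b ^ (-p) * (2 ^ |p - β| * b ^ (p - β)) := by gcongr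
          _ = (3 ^ |p| * 2 ^ |p - β| + 0) * (0 + b ^ (-β)) := by
              rw [sub_eq_add_neg, Real.rpow_add hb0, Real.rpow_neg hb0.le p]; field_simp; ring
          _ ≤ _ := by rw [hS₂]; gcongr; positivity
      · have u1 : b ^ (-p) ≤ 2 ^ |p| * d ^ (-p) := by
          rw [abs_of_nonpos hp0, ← Real.mul_rpow (by norm_num) hd0.le]
          exact Real.rpow_le_rpow hb0.le hb2 (by linarith)
        have u2 : d ^ (-p - β) ≤ 3 ^ |p + β| * a ^ (-p - β) := by
          rw [abs_of_nonneg (by linarith)]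
          have : ((3 : ℝ) ^ (p + β)) = (3⁻¹ : ℝ) ^ (-p - β) := by
            rw [Real.inv_rpow (by norm_num), ← Real.rpow_neg (by norm_num)]; ring_nf
          rw [this, ← Real.mul_rpow (by norm_num) ha0.le]
          exact Real.rpow_le_rpow_of_nonpos (by positivity) (by linarith) (by linarith)
        calc Q * d ^ (-β) = a ^ p * b ^ (-p) * d ^ (-β) := by
              rw [hQ, Real.div_rpow ha0.le hb0.le, Real.rpow_neg hb0.le p]; ring
          _ ≤ a ^ p * (2 ^ |p| * d ^ (-p)) * d ^ (-β) := by gcongr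
          _ = 2 ^ |p| * a ^ p * d ^ (-p - β) := by
              rw [sub_eq_add_neg, Real.rpow_add hd0]; ring
          _ ≤ 2 ^ |p| * a ^ p * (3 ^ |p + β| * a ^ (-p - β)) := by gcongr
          _ = (0 + 2 ^ |p| * 3 ^ |p + β|) * (a ^ (-β) + 0) := by
              rw [sub_eq_add_neg, Real.rpow_add ha0, Real.rpow_neg ha0.le p]; field_simp; ring
          _ ≤ _ := by rw [hS₂]; gcongr; positivity
    calc _ ≤ Q * d ^ α + (Q + 1) * (2 ^ α * d ^ α) := by gcongr
      _ = ((1 + 2 ^ α) * (Q * d ^ (-β)) + 2 ^ α * d ^ (-β)) * d ^ (α + β) := by rw [← hdd]; ring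
      _ ≤ ((1 + 2 ^ α) * (S₂ * (a ^ (-β) + b ^ (-β))) + 2 ^ α * d ^ (-β)) * d ^ (α + β) := by gcongr
      _ ≤ _ := by
        gcongr
        have : 0 ≤ (S₁ + C₁) * (a ^ (-β) + b ^ (-β) + d ^ (-β)) := by positivity
        have : 0 ≤ 2 ^ α * (a ^ (-β) + b ^ (-β)) := by positivity
        have : 0 ≤ (1 + 2 ^ α) * S₂ * d ^ (-β) := by positivity
        linarith

end Weights

/-! ### The Japanese bracket. -/

section Bracket

variable {E : Type*} [NormedAddCommGroup E]

/-- The Japanese bracket `⟨x⟩ = (1 + ‖x‖²)^(1/2)`. -/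
noncomputable def bracket (x : E) : ℝ := √(1 + ‖x‖ ^ 2)

theorem one_le_bracket (x : E) : 1 ≤ bracket x := Real.one_le_sqrt.2 (by simp)

theorem bracket_pos (x : E) : 0 < bracket x := one_pos.trans_le (one_le_bracket x)

theorem bracket_sq (x : E) : bracket x ^ 2 = 1 + ‖x‖ ^ 2 := Real.sq_sqrt (by positivity)

theorem norm_le_bracket (x : E) : ‖x‖ ≤ bracket x := Real.le_sqrt_of_sq_le (by simp)

theorem bracket_le_one_add_norm (x : E) : bracket x ≤ 1 + ‖x‖ :=
  Real.sqrt_le_iff.2 ⟨by positivity, by nlinarith [norm_nonneg x]⟩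

theorem bracket_neg (x : E) : bracket (-x) = bracket x := by simp [bracket]

theorem bracket_rpow (x : E) (t : ℝ) : bracket x ^ t = (1 + ‖x‖ ^ 2) ^ (t / 2) := by
  rw [bracket, Real.sqrt_eq_rpow, ← Real.rpow_mul (by positivity)]
  ring_nf

@[fun_prop]
theorem continuous_bracket : Continuous (bracket : E → ℝ) := by unfold bracket; fun_prop

theorem continuous_bracket_rpow (t : ℝ) : Continuous (fun x : E => bracket x ^ t) :=
  continuous_bracket.rpow_const fun x => Or.inl (bracket_pos x).ne'

theorem bracket_le_bracket_add (x y : E) : bracket x ≤ bracket y + bracket (x - y) := by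
  have h1 : ‖x‖ ≤ ‖y‖ + ‖x - y‖ := by simpa using norm_add_le y (x - y)
  refine Real.sqrt_le_iff.2 ⟨(add_pos (bracket_pos _) (bracket_pos _)).le, ?_⟩
  have := bracket_sq y
  have := bracket_sq (x - y)
  have := norm_le_bracket y
  have := norm_le_bracket (x - y)
  have : ‖y‖ * ‖x - y‖ ≤ bracket y * bracket (x - y) := by gcongr; exact (bracket_pos y).le
  nlinarith [norm_nonneg x, norm_nonneg y, norm_nonneg (x - y)]

/-- Supplies the hypothesis `|a - b| ≤ d` of `commutator_weight_bound`. -/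
theorem abs_bracket_sub_le (x y : E) : |bracket x - bracket y| ≤ bracket (x - y) := by
  have h1 := bracket_le_bracket_add x y
  have h2 := bracket_le_bracket_add y x
  rw [← bracket_neg (y - x), neg_sub] at h2
  rw [abs_le]
  constructor <;> linarith

end Bracket

/-! ### Trilinear convolution estimates. -/

section Trilinear

/-- The `L²` norm of a function with values in `[0, ∞]`. -/
noncomputable def l2Norm {X : Type*} [MeasurableSpace X] (ν : Measure X) (f : X → ℝ≥0∞) : ℝ≥0∞ :=
  (∫⁻ x, f x ^ 2 ∂ν) ^ (1 / 2 : ℝ)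

theorem lintegral_mul_le_l2Norm {X : Type*} [MeasurableSpace X] {ν : Measure X}
    {f g : X → ℝ≥0∞} (hf : Measurable f) (hg : Measurable g) :
    ∫⁻ x, f x * g x ∂ν ≤ l2Norm ν f * l2Norm ν g := by
  have := ENNReal.lintegral_mul_le_Lp_mul_Lq ν Real.HolderConjugate.two_two hf.aemeasurable
    hg.aemeasurable
  simpa [l2Norm] using this

theorem l2Norm_mono {X : Type*} [MeasurableSpace X] {ν : Measure X} {f g : X → ℝ≥0∞}
    (h : ∀ x, f x ≤ g x) : l2Norm ν f ≤ l2Norm ν g := by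
  unfold l2Norm
  gcongr with x
  exact h x

theorem l2Norm_sq {X : Type*} [MeasurableSpace X] {ν : Measure X} (f : X → ℝ≥0∞) :
    l2Norm ν f ^ 2 = ∫⁻ x, f x ^ 2 ∂ν := by
  rw [l2Norm, ← ENNReal.rpow_natCast, ← ENNReal.rpow_mul]
  simp

theorem l2Norm_enorm {X F : Type*} [MeasurableSpace X] [NormedAddCommGroup F] {ν : Measure X}
    (f : X → F) : l2Norm ν (fun x => ‖f x‖ₑ) = eLpNorm f 2 ν := by
  rw [l2Norm, eLpNorm_eq_lintegral_rpow_enorm_toReal (by norm_num) (by norm_num)]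
  simp

variable {E : Type*} [NormedAddCommGroup E] [MeasurableSpace E] [BorelSpace E] {μ : Measure E}

theorem l2Norm_sub_right [μ.IsAddLeftInvariant] (f : E → ℝ≥0∞) (y : E) : l2Norm μ (fun x => f (x - y)) = l2Norm μ f := by
  unfold l2Norm
  rw [lintegral_sub_right_eq_self (fun x => f x ^ 2) y]

theorem l2Norm_sub_left [μ.IsAddLeftInvariant] [μ.IsNegInvariant] (f : E → ℝ≥0∞) (x : E) : l2Norm μ (fun y => f (x - y)) = l2Norm μ f := by
  unfold l2Norm
  rw [lintegral_sub_left_eq_self (fun y => f y ^ 2) x]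

variable {h f g ω : E → ℝ≥0∞}

/-- For fixed `x`, Cauchy-Schwarz in `y` bounds the inner integral independently of `x`. -/
theorem lintegral_trilinear_le_left [μ.IsAddLeftInvariant] [μ.IsNegInvariant]
    (hh : Measurable h) (hf : Measurable f) (hg : Measurable g) :
    ∫⁻ x, ∫⁻ y, h x * f (x - y) * g y ∂μ ∂μ ≤ (∫⁻ x, h x ∂μ) * (l2Norm μ f * l2Norm μ g) := by
  calc _ = ∫⁻ x, h x * (∫⁻ y, f (x - y) * g y ∂μ) ∂μ := by
        refine lintegral_congr fun x => ?_
        rw [← lintegral_const_mul _ (by fun_prop)]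
        simp only [mul_assoc]
    _ ≤ ∫⁻ x, h x * (l2Norm μ f * l2Norm μ g) ∂μ := by
        refine lintegral_mono fun x => ?_
        gcongr
        refine (lintegral_mul_le_l2Norm (f := fun y => f (x - y)) (by fun_prop) hg).trans_eq ?_
        rw [l2Norm_sub_left]
    _ = _ := lintegral_mul_const _ hh

variable [SecondCountableTopology E] [SFinite μ] [μ.IsAddLeftInvariant]

theorem lintegral_trilinear_le_right (hh : Measurable h) (hf : Measurable f) (hg : Measurable g) :
    ∫⁻ x, ∫⁻ y, h x * f (x - y) * g y ∂μ ∂μ ≤ l2Norm μ h * l2Norm μ f * ∫⁻ x, g x ∂μ := by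
  rw [lintegral_lintegral_swap (by fun_prop)]
  calc _ = ∫⁻ y, (∫⁻ x, h x * f (x - y) ∂μ) * g y ∂μ := by
        refine lintegral_congr fun y => ?_
        exact lintegral_mul_const _ (by fun_prop)
    _ ≤ ∫⁻ y, l2Norm μ h * l2Norm μ f * g y ∂μ := by
        refine lintegral_mono fun y => ?_
        gcongr
        refine (lintegral_mul_le_l2Norm hh (g := fun x => f (x - y)) (by fun_prop)).trans_eq ?_
        rw [l2Norm_sub_right]
    _ = _ := lintegral_const_mul _ hg

variable [μ.IsNegInvariant]

/-- The substitution `y ↦ x - y` exchanges `f` and `g`, reducing to `lintegral_trilinear_le_right`.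
-/
theorem lintegral_trilinear_le_mid (hh : Measurable h) (hf : Measurable f) (hg : Measurable g) :
    ∫⁻ x, ∫⁻ y, h x * f (x - y) * g y ∂μ ∂μ ≤ l2Norm μ h * l2Norm μ g * ∫⁻ x, f x ∂μ := by
  refine le_trans (le_of_eq ?_) (lintegral_trilinear_le_right hh hg hf)
  refine lintegral_congr fun x => ?_
  rw [← lintegral_sub_left_eq_self _ x]
  simp only [sub_sub_cancel]
  exact lintegral_congr fun y => by ring

/-- Each summand of the weight is given to the factor with the same argument. By Cauchy-Schwarz with
`ω ∈ L²` that factor becomes integrable, and the other two stay in `L²`; the three cases are the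
three preceding estimates. -/
theorem lintegral_trilinear_weight_le (hh : Measurable h) (hf : Measurable f) (hg : Measurable g)
    (hω : Measurable ω) :
    ∫⁻ x, ∫⁻ y, h x * f (x - y) * g y * (ω x + ω y + ω (x - y)) ∂μ ∂μ ≤
      3 * (l2Norm μ h * l2Norm μ f * l2Norm μ g * l2Norm μ ω) := by
  have e : ∀ x y, h x * f (x - y) * g y * (ω x + ω y + ω (x - y)) =
      (h * ω) x * f (x - y) * g y + h x * f (x - y) * (g * ω) y + h x * (f * ω) (x - y) * g y :=
    fun x y => by simp only [Pi.mul_apply]; ring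
  simp only [e]
  have m1 : Measurable fun z : E × E => (h * ω) z.1 * f (z.1 - z.2) * g z.2 := by
    fun_prop
  have m2 : Measurable fun z : E × E => h z.1 * f (z.1 - z.2) * (g * ω) z.2 := by
    fun_prop
  have s : ∀ x, ∫⁻ y, ((h * ω) x * f (x - y) * g y + h x * f (x - y) * (g * ω) y +
      h x * (f * ω) (x - y) * g y) ∂μ = (∫⁻ y, (h * ω) x * f (x - y) * g y ∂μ) +
      (∫⁻ y, h x * f (x - y) * (g * ω) y ∂μ) + ∫⁻ y, h x * (f * ω) (x - y) * g y ∂μ := fun x => by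
    rw [lintegral_add_left (by fun_prop), lintegral_add_left (by fun_prop)]
  simp only [s]
  have n1 : Measurable fun x => ∫⁻ y, (h * ω) x * f (x - y) * g y ∂μ := m1.lintegral_prod_right'
  have n2 : Measurable fun x => ∫⁻ y, h x * f (x - y) * (g * ω) y ∂μ := m2.lintegral_prod_right'
  have n3 : Measurable fun x => (∫⁻ y, (h * ω) x * f (x - y) * g y ∂μ) +
    ∫⁻ y, h x * f (x - y) * (g * ω) y ∂μ := n1.add n2
  rw [lintegral_add_left n3, lintegral_add_left n1]
  have t1 := lintegral_trilinear_le_left (μ := μ) (hh.mul hω) hf hg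
  have t2 := lintegral_trilinear_le_right (μ := μ) hh hf (hg.mul hω)
  have t3 := lintegral_trilinear_le_mid (μ := μ) hh (hf.mul hω) hg
  have u1 : ∫⁻ x, (h * ω) x ∂μ ≤ _ := lintegral_mul_le_l2Norm hh hω
  have u2 : ∫⁻ x, (g * ω) x ∂μ ≤ _ := lintegral_mul_le_l2Norm hg hω
  have u3 : ∫⁻ x, (f * ω) x ∂μ ≤ _ := lintegral_mul_le_l2Norm hf hω
  calc _ ≤ l2Norm μ h * l2Norm μ ω * (l2Norm μ f * l2Norm μ g) +
        l2Norm μ h * l2Norm μ f * (l2Norm μ g * l2Norm μ ω) +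
        l2Norm μ h * l2Norm μ g * (l2Norm μ f * l2Norm μ ω) := by
        gcongr
        · exact t1.trans (by gcongr)
        · exact t2.trans (by gcongr)
        · exact t3.trans (by gcongr)
    _ = _ := by ring

end Trilinear

/-! ### The energy estimate and the gain of `α` derivatives. -/

section Energy

theorem l2Norm_const_mul {X : Type*} [MeasurableSpace X] {ν : Measure X} {c : ℝ≥0∞} (hc : c ≠ ∞)
    (f : X → ℝ≥0∞) : l2Norm ν (fun x => c * f x) = c * l2Norm ν f := by
  simp only [l2Norm, mul_pow]
  rw [lintegral_const_mul' _ _ (by finiteness), ENNReal.mul_rpow_of_nonneg _ _ (by norm_num),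
    ← ENNReal.rpow_natCast, ← ENNReal.rpow_mul]
  simp

/-- The multiplier `⟨x⟩ ^ p * min(⟨x⟩, R) ^ α`, of order `p` for finite `R` and of order `p + α` in
the limit `R → ∞`. -/
noncomputable def truncWeight {E : Type*} [NormedAddCommGroup E] (p α R : ℝ) (x : E) : ℝ :=
  bracket x ^ p * min (bracket x) R ^ α

section TruncWeight

variable {E : Type*} [NormedAddCommGroup E] {p α R : ℝ}

theorem truncWeight_nonneg (hR : 1 ≤ R) (x : E) : 0 ≤ truncWeight p α R x := by
  have := bracket_pos x
  have : 0 ≤ min (bracket x) R := le_min this.le (by linarith)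
  unfold truncWeight
  positivity

theorem truncWeight_le (hα : 0 ≤ α) (hR : 1 ≤ R) (x : E) :
    truncWeight p α R x ≤ bracket x ^ (p + α) := by
  have h := bracket_pos x
  rw [truncWeight, Real.rpow_add h]
  have : 0 ≤ min (bracket x) R := le_min h.le (by linarith)
  gcongr
  exact min_le_left _ _

/-- For fixed `R` the truncated weight costs only `p` derivatives, which makes the energy finite
before it is estimated. -/
theorem truncWeight_le_mul (hα : 0 ≤ α) (hR : 1 ≤ R) (x : E) :
    truncWeight p α R x ≤ R ^ α * bracket x ^ p := by
  have h := bracket_pos x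
  rw [truncWeight, mul_comm]
  have : 0 ≤ min (bracket x) R := le_min h.le (by linarith)
  gcongr
  exact min_le_right _ _

theorem truncWeight_of_le {x : E} (h : bracket x ≤ R) :
    truncWeight p α R x = bracket x ^ (p + α) := by
  rw [truncWeight, min_eq_left h, Real.rpow_add (bracket_pos x)]

theorem continuous_truncWeight (hα : 0 ≤ α) : Continuous (truncWeight p α R : E → ℝ) :=
  (continuous_bracket_rpow p).mul
    ((continuous_bracket.min continuous_const).rpow_const fun _ => Or.inr hα)

theorem exists_truncWeight_commutator_bound {β : ℝ} (hα0 : 0 ≤ α) (hα1 : α ≤ 1) (hp : -β ≤ p)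
    (hpβ : p ≤ β) : ∃ C : ℝ, 0 ≤ C ∧ ∀ R : ℝ, 1 ≤ R → ∀ x y : E,
      |truncWeight p α R x - truncWeight p α R y| ≤
        C * (bracket x ^ (-β) + bracket y ^ (-β) + bracket (x - y) ^ (-β)) *
          bracket (x - y) ^ (α + β) * bracket y ^ p := by
  obtain ⟨C, hC, h⟩ := commutator_weight_bound hα0 hα1 hp hpβ
  exact ⟨C, hC, fun R hR x y => h _ _ _ R (one_le_bracket x) (one_le_bracket y)
    (one_le_bracket _) hR (abs_bracket_sub_le x y)⟩

end TruncWeight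

variable {E : Type*} [NormedAddCommGroup E] [InnerProductSpace ℝ E] [FiniteDimensional ℝ E]
  [MeasurableSpace E] [BorelSpace E]

/-- In the commutator bound `⟨x-y⟩^(α+β)` is given to `k`, and `⟨y⟩^p |y| ≤ ⟨y⟩^(p+1)` to `V`. No
weight falls on `h`, which will be the energy density itself, so the commutator is only linear in
the energy norm. -/
theorem lintegral_commutator_le {k V : E → ℂ} (hk : Measurable k) (hV : Measurable V)
    {p α β : ℝ} (hα0 : 0 ≤ α) (hα1 : α ≤ 1) (hp : -β ≤ p) (hpβ : p ≤ β) :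
    ∃ C : ℝ, ∀ R : ℝ, 1 ≤ R → ∀ h : E → ℝ≥0∞, Measurable h →
      ∫⁻ x, ∫⁻ y, h x * ‖k (x - y)‖ₑ *
          (ENNReal.ofReal |truncWeight p α R x - truncWeight p α R y| * ‖y‖ₑ * ‖V y‖ₑ) ≤
        ENNReal.ofReal C * (3 * (l2Norm volume h *
          l2Norm volume (fun x => ENNReal.ofReal (bracket x ^ (α + β)) * ‖k x‖ₑ) *
          l2Norm volume (fun x => ENNReal.ofReal (bracket x ^ (p + 1)) * ‖V x‖ₑ) *
          l2Norm volume (fun x : E => ENNReal.ofReal (bracket x ^ (-β))))) := by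
  obtain ⟨C, hC, hb⟩ := exists_truncWeight_commutator_bound (E := E) hα0 hα1 hp hpβ
  have hm : ∀ t : ℝ, Measurable fun x : E => ENNReal.ofReal (bracket x ^ t) := fun t =>
    ENNReal.measurable_ofReal.comp (continuous_bracket_rpow t).measurable
  refine ⟨C, fun R hR h hh => ?_⟩
  refine le_trans ?_ (mul_le_mul_right (lintegral_trilinear_weight_le (μ := volume) hh
    (f := fun x => ENNReal.ofReal (bracket x ^ (α + β)) * ‖k x‖ₑ)
    (g := fun x => ENNReal.ofReal (bracket x ^ (p + 1)) * ‖V x‖ₑ)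
    (ω := fun x => ENNReal.ofReal (bracket x ^ (-β)))
    ((hm _).mul hk.enorm) ((hm _).mul hV.enorm) (hm _)) _)
  rw [← lintegral_const_mul' _ _ ENNReal.ofReal_ne_top]
  refine lintegral_mono fun x => ?_
  rw [← lintegral_const_mul' _ _ ENNReal.ofReal_ne_top]
  refine lintegral_mono fun y => ?_
  have b0 := fun z : E => bracket_pos z
  have key : ENNReal.ofReal |truncWeight p α R x - truncWeight p α R y| * ‖y‖ₑ ≤
      ENNReal.ofReal C * (ENNReal.ofReal (bracket x ^ (-β)) + ENNReal.ofReal (bracket y ^ (-β)) +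
        ENNReal.ofReal (bracket (x - y) ^ (-β))) * ENNReal.ofReal (bracket (x - y) ^ (α + β)) *
        ENNReal.ofReal (bracket y ^ (p + 1)) := by
    have p1 := fun (z : E) (t : ℝ) => (Real.rpow_pos_of_pos (b0 z) t).le
    rw [← ofReal_norm y, ← ENNReal.ofReal_mul (abs_nonneg _), ← ENNReal.ofReal_add (p1 _ _) (p1 _ _),
      ← ENNReal.ofReal_add (add_nonneg (p1 _ _) (p1 _ _)) (p1 _ _), ← ENNReal.ofReal_mul hC,
      ← ENNReal.ofReal_mul (by have := p1 x (-β); have := p1 y (-β); have := p1 (x - y) (-β); positivity),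
      ← ENNReal.ofReal_mul (by have := p1 x (-β); have := p1 y (-β); have := p1 (x - y) (-β);
                               have := p1 (x - y) (α + β); positivity)]
    refine ENNReal.ofReal_le_ofReal ?_
    rw [Real.rpow_add (b0 y) p 1, Real.rpow_one, ← mul_assoc]
    have := p1 x (-β); have := p1 y (-β); have := p1 (x - y) (-β)
    have := p1 (x - y) (α + β); have := p1 y p
    exact mul_le_mul (hb R hR x y) (norm_le_bracket y) (norm_nonneg _) (by positivity)
  calc _ ≤ h x * ‖k (x - y)‖ₑ * (ENNReal.ofReal C * (ENNReal.ofReal (bracket x ^ (-β)) +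
        ENNReal.ofReal (bracket y ^ (-β)) +
        ENNReal.ofReal (bracket (x - y) ^ (-β))) * ENNReal.ofReal (bracket (x - y) ^ (α + β)) *
        ENNReal.ofReal (bracket y ^ (p + 1)) * ‖V y‖ₑ) := by gcongr
    _ = _ := by ring

open ComplexConjugate in
/-- The a priori estimate behind the gain of `α` derivatives. -/
theorem exists_energy_bound {k V F : E → ℂ} (hk : Measurable k) (hV : Measurable V)
    (hF : Measurable F) {c₀ p α β s : ℝ} (hc₀ : 0 < c₀)
    (hα0 : 0 ≤ α) (hα1 : α ≤ 1) (hp : -β ≤ p) (hpβ : p ≤ β) (hps : p + α - 1 ≤ s)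
    (hβ : l2Norm volume (fun x : E => ENNReal.ofReal (bracket x ^ (-β))) ≠ ∞)
    (hk2 : l2Norm volume (fun x => ENNReal.ofReal (bracket x ^ (α + β)) * ‖k x‖ₑ) ≠ ∞)
    (hk1 : ∫⁻ x, ‖k x‖ₑ ≠ ∞)
    (hpos : ∀ h : E → ℂ, Measurable h → MemLp h 2 →
      0 ≤ (∫ z : E × E, conj (h z.1) * k (z.1 - z.2) * h z.2 ∂(volume.prod volume)).re)
    (hV2 : l2Norm volume (fun x => ENNReal.ofReal (bracket x ^ (p + 1)) * ‖V x‖ₑ) ≠ ∞)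
    (hF2 : l2Norm volume (fun x => ENNReal.ofReal (bracket x ^ s) * ‖F x‖ₑ) ≠ ∞)
    (heq : ∀ᵐ x, c₀ * ‖x‖ ^ 2 * V x + ∫ y, k (x - y) * inner ℝ x y * V y = F x) :
    ∃ B : ℝ≥0∞, B ≠ ∞ ∧ ∀ R : ℝ, 1 ≤ R →
      l2Norm volume (fun x => ENNReal.ofReal (truncWeight p α R x) * ‖x‖ₑ * ‖V x‖ₑ) ≤ B := by
  obtain ⟨C, hC⟩ := lintegral_commutator_le hk hV hα0 hα1 hp hpβ
  set Nω := l2Norm volume (fun x : E => ENNReal.ofReal (bracket x ^ (-β)))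
  set Nk := l2Norm volume (fun x => ENNReal.ofReal (bracket x ^ (α + β)) * ‖k x‖ₑ)
  set NV := l2Norm volume (fun x => ENNReal.ofReal (bracket x ^ (p + 1)) * ‖V x‖ₑ)
  set NF := l2Norm volume (fun x => ENNReal.ofReal (bracket x ^ s) * ‖F x‖ₑ)
  have hm : ∀ t : ℝ, Measurable fun x : E => ENNReal.ofReal (bracket x ^ t) := fun t =>
    ENNReal.measurable_ofReal.comp (continuous_bracket_rpow t).measurable
  -- The quotient comes from dividing the quadratic inequality `hmain` by `X` when `X > 1`; the
  -- `max` covers `X ≤ 1`.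
  refine ⟨max 1 ((NF + NV * NF + ENNReal.ofReal C * (3 * (Nk * NV * Nω))) / ENNReal.ofReal c₀),
    ?_, fun R hR => ?_⟩
  · refine (max_lt ENNReal.one_lt_top (ENNReal.div_lt_top ?_ (by simpa using hc₀))).ne
    finiteness
  have hc : Continuous (truncWeight p α R : E → ℝ) := continuous_truncWeight hα0
  have hn : ∀ x : E, 0 ≤ truncWeight p α R x := truncWeight_nonneg hR
  set A : E → ℝ≥0∞ := fun x => ENNReal.ofReal (truncWeight p α R x) * ‖x‖ₑ * ‖V x‖ₑ with hA
  have hmW : Measurable fun x : E => ENNReal.ofReal (truncWeight p α R x) :=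
    ENNReal.measurable_ofReal.comp hc.measurable
  have hAm : Measurable A := (hmW.mul measurable_enorm).mul hV.enorm
  set X := l2Norm volume A with hX
  have b0 := fun z : E => bracket_pos z
  have p1 := fun (z : E) (t : ℝ) => (Real.rpow_pos_of_pos (b0 z) t).le
  have heR : ∀ t : ℝ, ‖(t : ℂ)‖ₑ = ‖t‖ₑ := fun t => by
    rw [← ofReal_norm, Complex.norm_real, ofReal_norm]
  have heN : ∀ x : E, ‖x‖ₑ ≤ ENNReal.ofReal (bracket x) := fun x => by
    rw [← ofReal_norm]
    exact ENNReal.ofReal_le_ofReal (norm_le_bracket x)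
  -- This bound depends on `R`; it only serves to make the energy finite, so that integrals can be
  -- split and `X` cancelled.
  have hXfin : X ≠ ∞ := by
    have : X ≤ ENNReal.ofReal (R ^ α) * NV := by
      rw [← l2Norm_const_mul ENNReal.ofReal_ne_top]
      refine l2Norm_mono fun x => ?_
      have h1 : ENNReal.ofReal (truncWeight p α R x) ≤
          ENNReal.ofReal (R ^ α) * ENNReal.ofReal (bracket x ^ p) := by
        rw [← ENNReal.ofReal_mul (by positivity)]
        exact ENNReal.ofReal_le_ofReal (truncWeight_le_mul hα0 hR x)
      calc A x ≤ ENNReal.ofReal (R ^ α) * ENNReal.ofReal (bracket x ^ p) *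
            ENNReal.ofReal (bracket x) * ‖V x‖ₑ := by
            simp only [hA]
            gcongr
            exact heN x
        _ = _ := by
            rw [Real.rpow_add (b0 x), Real.rpow_one, ENNReal.ofReal_mul (p1 x p)]
            ring
    exact ne_top_of_le_ne_top (by finiteness) this
  -- the three parts of the energy identity
  set P : E × E → ℂ := fun z => (truncWeight p α R z.1 * truncWeight p α R z.2 * inner ℝ z.1 z.2 : ℝ) *
    (conj (V z.1) * k (z.1 - z.2) * V z.2) with hP
  set Q : E × E → ℂ := fun z => (truncWeight p α R z.1 *
    (truncWeight p α R z.1 - truncWeight p α R z.2) * inner ℝ z.1 z.2 : ℝ) *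
    (conj (V z.1) * k (z.1 - z.2) * V z.2) with hQ
  have hPm : Measurable P := by
    have := hc.measurable
    fun_prop
  have hQm : Measurable Q := by
    have := hc.measurable
    fun_prop
  have hinner : ∀ x y : E, ‖(inner ℝ x y : ℝ)‖ₑ ≤ ‖x‖ₑ * ‖y‖ₑ := fun x y => by
    rw [← ofReal_norm, ← ofReal_norm x, ← ofReal_norm y, ← ENNReal.ofReal_mul (norm_nonneg _)]
    exact ENNReal.ofReal_le_ofReal (norm_inner_le_norm x y)
  have heW : ∀ x : E, ‖truncWeight p α R x‖ₑ = ENNReal.ofReal (truncWeight p α R x) := fun x =>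
    Real.enorm_of_nonneg (hn x)
  have hPle : ∫⁻ z, ‖P z‖ₑ ∂(volume.prod volume) ≤ X * X * ∫⁻ x, ‖k x‖ₑ := by
    rw [lintegral_prod _ hPm.enorm.aemeasurable]
    refine le_trans ?_ (lintegral_trilinear_le_mid hAm hk.enorm hAm)
    refine lintegral_mono fun x => lintegral_mono fun y => ?_
    simp only [hP, hA, Complex.ofReal_mul, enorm_mul, heR, heW, RCLike.enorm_conj]
    calc _ ≤ ENNReal.ofReal (truncWeight p α R x) * ENNReal.ofReal (truncWeight p α R y) *
          (‖x‖ₑ * ‖y‖ₑ) * (‖V x‖ₑ * ‖k (x - y)‖ₑ * ‖V y‖ₑ) := by gcongr; exact hinner x y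
      _ = _ := by ring
  have hQle : ∫⁻ z, ‖Q z‖ₑ ∂(volume.prod volume) ≤
      ENNReal.ofReal C * (3 * (X * Nk * NV * Nω)) := by
    rw [lintegral_prod _ hQm.enorm.aemeasurable]
    refine le_trans ?_ (hC R hR A hAm)
    refine lintegral_mono fun x => lintegral_mono fun y => ?_
    simp only [hQ, hA, Complex.ofReal_mul, enorm_mul, heR, heW, RCLike.enorm_conj]
    rw [← Real.enorm_eq_ofReal_abs (truncWeight p α R x - truncWeight p α R y)]
    calc _ ≤ ENNReal.ofReal (truncWeight p α R x) * ‖truncWeight p α R x - truncWeight p α R y‖ₑ *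
          (‖x‖ₑ * ‖y‖ₑ) * (‖V x‖ₑ * ‖k (x - y)‖ₑ * ‖V y‖ₑ) := by gcongr; exact hinner x y
      _ = _ := by ring
  have hPi : Integrable P (volume.prod volume) :=
    ⟨hPm.aestronglyMeasurable, lt_of_le_of_lt hPle (by finiteness)⟩
  have hQi : Integrable Q (volume.prod volume) :=
    ⟨hQm.aestronglyMeasurable, lt_of_le_of_lt hQle (by finiteness)⟩
  -- Expanding `x·y` in an orthonormal basis writes `P` as a sum of forms `conj G_i(x) k(x-y)
  -- G_i(y)`, to each of which `hpos` applies.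
  have hPre : 0 ≤ (∫ z, P z ∂(volume.prod volume)).re := by
    let b := stdOrthonormalBasis ℝ E
    let G : Fin (Module.finrank ℝ E) → E → ℂ := fun i x =>
      (inner ℝ x (b i) * truncWeight p α R x : ℝ) * V x
    have hGm : ∀ i, Measurable (G i) := fun i => by
      have := hc.measurable
      fun_prop
    have hGA : ∀ i x, ‖G i x‖ₑ ≤ A x := fun i x => by
      simp only [G, hA, Complex.ofReal_mul, enorm_mul, heR, heW]
      rw [mul_comm ‖(inner ℝ x (b i) : ℝ)‖ₑ]
      gcongr
      refine (hinner x (b i)).trans_eq ?_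
      rw [← ofReal_norm (b i), b.orthonormal.1 i, ENNReal.ofReal_one, mul_one]
    have hG2 : ∀ i, MemLp (G i) 2 := fun i => by
      refine ⟨(hGm i).aestronglyMeasurable, ?_⟩
      rw [← l2Norm_enorm]
      exact (l2Norm_mono (hGA i)).trans_lt hXfin.lt_top
    have hGi : ∀ i, Integrable (fun z : E × E => conj (G i z.1) * k (z.1 - z.2) * G i z.2)
        (volume.prod volume) := fun i => by
      have hm' : Measurable fun z : E × E => conj (G i z.1) * k (z.1 - z.2) * G i z.2 := by
        have := hGm i
        fun_prop
      have hle : ∫⁻ z : E × E, ‖conj (G i z.1) * k (z.1 - z.2) * G i z.2‖ₑ ∂(volume.prod volume) ≤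
          X * X * ∫⁻ x, ‖k x‖ₑ := by
        rw [lintegral_prod _ hm'.enorm.aemeasurable]
        refine le_trans ?_ (lintegral_trilinear_le_mid hAm hk.enorm hAm)
        refine lintegral_mono fun x => lintegral_mono fun y => ?_
        simp only [enorm_mul, RCLike.enorm_conj]
        gcongr
        · exact hGA i x
        · exact hGA i y
      exact ⟨hm'.aestronglyMeasurable, hle.trans_lt (by finiteness)⟩
    have hPG : P = fun z => ∑ i, conj (G i z.1) * k (z.1 - z.2) * G i z.2 := by
      funext z
      have := b.sum_inner_mul_inner z.1 z.2
      simp only [hP, G, ← this]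
      rw [Finset.mul_sum, Complex.ofReal_sum, Finset.sum_mul]
      refine Finset.sum_congr rfl fun i _ => ?_
      rw [real_inner_comm (b i) z.2]
      push_cast
      simp only [map_mul, Complex.conj_ofReal]
      ring
    rw [hPG, integral_finsetSum _ fun i _ => hGi i, Complex.re_sum]
    exact Finset.sum_nonneg fun i _ => hpos (G i) (hGm i) (hG2 i)
  set H : E → ℂ := fun x => (truncWeight p α R x ^ 2 : ℝ) * (conj (V x) * F x) with hH
  have hHm : Measurable H := by
    have := hc.measurable
    fun_prop
  have hHle : ∫⁻ x, ‖H x‖ₑ ≤ (X + NV) * NF := by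
    set g : E → ℝ≥0∞ := fun x => ENNReal.ofReal (bracket x ^ (p + 1)) * ‖V x‖ₑ with hg
    set f : E → ℝ≥0∞ := fun x => ENNReal.ofReal (bracket x ^ s) * ‖F x‖ₑ with hf
    have hgm : Measurable g := (hm _).mul hV.enorm
    have hfm : Measurable f := (hm _).mul hF.enorm
    calc ∫⁻ x, ‖H x‖ₑ ≤ ∫⁻ x, (A x * f x + g x * f x) := by
          refine lintegral_mono fun x => ?_
          have w1 : truncWeight p α R x ≤ bracket x ^ (p + 1) :=
            (truncWeight_le hα0 hR x).trans
              (Real.rpow_le_rpow_of_exponent_le (one_le_bracket x) (by linarith))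
          have w2 : truncWeight p α R x ≤ bracket x ^ s * bracket x := by
            refine (truncWeight_le hα0 hR x).trans ?_
            rw [← Real.rpow_add_one (b0 x).ne']
            exact Real.rpow_le_rpow_of_exponent_le (one_le_bracket x) (by linarith)
          -- One factor `W` is bounded by `⟨x⟩^s ⟨x⟩` through `p + α - 1 ≤ s`. Then `⟨x⟩ ≤ 1 + |x|`
          -- splits off the energy density, and the rest is bounded by `⟨x⟩^(p+1)` because `α ≤ 1`.
          have w3 : truncWeight p α R x ^ 2 ≤
              (truncWeight p α R x * ‖x‖ + bracket x ^ (p + 1)) * bracket x ^ s := by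
            have := hn x
            have := p1 x s
            calc _ = truncWeight p α R x * truncWeight p α R x := sq _
              _ ≤ truncWeight p α R x * (bracket x ^ s * bracket x) := by gcongr
              _ ≤ truncWeight p α R x * (bracket x ^ s * (1 + ‖x‖)) := by
                  gcongr
                  exact bracket_le_one_add_norm x
              _ = (truncWeight p α R x * ‖x‖ + truncWeight p α R x) * bracket x ^ s := by ring
              _ ≤ _ := by gcongr
          have w4 : ENNReal.ofReal (truncWeight p α R x ^ 2) ≤
              (ENNReal.ofReal (truncWeight p α R x) * ‖x‖ₑ + ENNReal.ofReal (bracket x ^ (p + 1))) *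
                ENNReal.ofReal (bracket x ^ s) := by
            have := hn x
            have := p1 x (p + 1)
            rw [← ofReal_norm x, ← ENNReal.ofReal_mul (hn x), ← ENNReal.ofReal_add (by positivity)
              (by positivity), ← ENNReal.ofReal_mul (by positivity)]
            exact ENNReal.ofReal_le_ofReal w3
          simp only [hH, enorm_mul, heR, RCLike.enorm_conj]
          rw [Real.enorm_of_nonneg (sq_nonneg _)]
          calc _ ≤ _ := mul_le_mul_left w4 _
            _ = _ := by simp only [hA, hf, hg]; ring
      _ = (∫⁻ x, A x * f x) + ∫⁻ x, g x * f x := lintegral_add_left (hAm.mul hfm) _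
      _ ≤ X * NF + NV * NF :=
          add_le_add (lintegral_mul_le_l2Norm hAm hfm) (lintegral_mul_le_l2Norm hgm hfm)
      _ = _ := by ring
  have hAr : ∀ x, (A x).toReal = truncWeight p α R x * ‖x‖ * ‖V x‖ := fun x => by
    simp [hA, ENNReal.toReal_ofReal (hn x)]
  -- The equation times `W(x)² conj V(x)`: the weights in `P` and `Q` recombine, since `W(x)W(y) +
  -- W(x)(W(x) - W(y)) = W(x)²`.
  have hident : ∀ᵐ x, ((c₀ * (A x).toReal ^ 2 : ℝ) : ℂ) + ∫ y, (P (x, y) + Q (x, y)) = H x := by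
    filter_upwards [heq] with x hx
    have e : ∀ y, P (x, y) + Q (x, y) =
        (truncWeight p α R x ^ 2 : ℝ) * conj (V x) * (k (x - y) * inner ℝ x y * V y) := fun y => by
      simp only [hP, hQ]
      push_cast
      ring
    simp only [e]
    rw [integral_const_mul, hAr, hH]
    simp only
    rw [← hx]
    have := Complex.conj_mul' (V x)
    push_cast
    linear_combination (-c₀ * (truncWeight p α R x : ℂ) ^ 2 * ‖x‖ ^ 2) * this
  have hA2 : ∫⁻ x, A x ^ 2 ≠ ∞ := by
    rw [← l2Norm_sq]
    finiteness
  have hAi : Integrable fun x => c₀ * (A x).toReal ^ 2 := by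
    have := integrable_toReal_of_lintegral_ne_top (hAm.pow_const 2).aemeasurable hA2
    simp only [ENNReal.toReal_pow] at this
    exact this.const_mul _
  have hAint : ENNReal.ofReal (∫ x, c₀ * (A x).toReal ^ 2) = ENNReal.ofReal c₀ * X ^ 2 := by
    rw [integral_const_mul, ENNReal.ofReal_mul hc₀.le]
    simp only [← ENNReal.toReal_pow]
    rw [integral_toReal (hAm.pow_const 2).aemeasurable
      (ae_lt_top (hAm.pow_const 2) hA2), ENNReal.ofReal_toReal hA2, l2Norm_sq]
  have hPQi : Integrable (fun z => P z + Q z) (volume.prod volume) := hPi.add hQi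
  have hmain : ENNReal.ofReal c₀ * X ^ 2 ≤ (X + NV) * NF +
      ENNReal.ofReal C * (3 * (X * Nk * NV * Nω)) := by
    have e1 : (∫ x, (((c₀ * (A x).toReal ^ 2 : ℝ) : ℂ) + ∫ y, (P (x, y) + Q (x, y)))) =
        ∫ x, H x := integral_congr_ae hident
    have i1 : Integrable fun x => ((c₀ * (A x).toReal ^ 2 : ℝ) : ℂ) := hAi.ofReal
    have i2 : Integrable fun x => ∫ y, (P (x, y) + Q (x, y)) := hPQi.integral_prod_left
    rw [integral_add i1 i2, integral_complex_ofReal,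
      ← integral_prod (fun z => P z + Q z) hPQi, integral_add hPi hQi] at e1
    have e2 := congrArg Complex.re e1
    simp only [Complex.add_re, Complex.ofReal_re] at e2
    -- Real parts are taken, and the contribution of `P` is dropped by positivity.
    have e3 : ∫ x, c₀ * (A x).toReal ^ 2 ≤ ‖∫ x, H x‖ + ‖∫ z, Q z ∂(volume.prod volume)‖ := by
      have := Complex.re_le_norm (∫ x, H x)
      have := (abs_le.1 (Complex.abs_re_le_norm (∫ z, Q z ∂(volume.prod volume)))).1
      linarith
    rw [← hAint]
    refine (ENNReal.ofReal_le_ofReal e3).trans ?_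
    rw [ENNReal.ofReal_add (norm_nonneg _) (norm_nonneg _), ofReal_norm, ofReal_norm]
    exact add_le_add ((enorm_integral_le_lintegral_enorm _).trans hHle)
      ((enorm_integral_le_lintegral_enorm _).trans hQle)
  rcases le_or_gt X 1 with h1 | h1
  · exact h1.trans (le_max_left _ _)
  refine le_trans ?_ (le_max_right _ _)
  rw [ENNReal.le_div_iff_mul_le (Or.inl (by simpa using hc₀)) (Or.inl ENNReal.ofReal_ne_top)]
  have hX0 : X ≠ 0 := (zero_lt_one.trans h1).ne'
  -- Cancelling `X` needs it nonzero and finite. Since `X > 1`, the term `NV * NF` without a factor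
  -- `X` may be multiplied by one.
  rw [← ENNReal.mul_le_mul_iff_right hX0 hXfin]
  calc X * (X * ENNReal.ofReal c₀) = ENNReal.ofReal c₀ * X ^ 2 := by ring
    _ ≤ _ := hmain
    _ = X * NF + 1 * (NV * NF) + X * (ENNReal.ofReal C * (3 * (Nk * NV * Nω))) := by ring
    _ ≤ X * NF + X * (NV * NF) + X * (ENNReal.ofReal C * (3 * (Nk * NV * Nω))) := by gcongr
    _ = _ := by ring

open ComplexConjugate in
/-- Gain of `α` derivatives for a solution of the equation on the Fourier side. -/
theorem l2Norm_bracket_ne_top_of_equation {k V F : E → ℂ} (hk : Measurable k) (hV : Measurable V)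
    (hF : Measurable F) {c₀ p α β s : ℝ} (hc₀ : 0 < c₀)
    (hα0 : 0 ≤ α) (hα1 : α ≤ 1) (hp : -β ≤ p) (hpβ : p ≤ β) (hps : p + α - 1 ≤ s)
    (hβ : l2Norm volume (fun x : E => ENNReal.ofReal (bracket x ^ (-β))) ≠ ∞)
    (hk2 : l2Norm volume (fun x => ENNReal.ofReal (bracket x ^ (α + β)) * ‖k x‖ₑ) ≠ ∞)
    (hk1 : ∫⁻ x, ‖k x‖ₑ ≠ ∞)
    (hpos : ∀ h : E → ℂ, Measurable h → MemLp h 2 →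
      0 ≤ (∫ z : E × E, conj (h z.1) * k (z.1 - z.2) * h z.2 ∂(volume.prod volume)).re)
    (hV2 : l2Norm volume (fun x => ENNReal.ofReal (bracket x ^ (p + 1)) * ‖V x‖ₑ) ≠ ∞)
    (hF2 : l2Norm volume (fun x => ENNReal.ofReal (bracket x ^ s) * ‖F x‖ₑ) ≠ ∞)
    (heq : ∀ᵐ x, c₀ * ‖x‖ ^ 2 * V x + ∫ y, k (x - y) * inner ℝ x y * V y = F x) :
    l2Norm volume (fun x => ENNReal.ofReal (bracket x ^ (p + 1 + α)) * ‖V x‖ₑ) ≠ ∞ := by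
  obtain ⟨B, hB, hbd⟩ := exists_energy_bound hk hV hF hc₀ hα0 hα1 hp hpβ hps hβ hk2 hk1 hpos hV2
    hF2 heq
  have hm : ∀ t : ℝ, Measurable fun x : E => ENNReal.ofReal (bracket x ^ t) := fun t =>
    ENNReal.measurable_ofReal.comp (continuous_bracket_rpow t).measurable
  have b0 := fun z : E => bracket_pos z
  -- The truncation heights are `n + 1`, so that `R ≥ 1` also for `n = 0`.
  set A : ℕ → E → ℝ≥0∞ := fun n x =>
    ENNReal.ofReal (truncWeight p α (n + 1) x) * ‖x‖ₑ * ‖V x‖ₑ with hA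
  set A' : E → ℝ≥0∞ := fun x => ENNReal.ofReal (bracket x ^ (p + α)) * ‖x‖ₑ * ‖V x‖ₑ with hA'
  have hAm : ∀ n, Measurable (A n) := fun n =>
    ((ENNReal.measurable_ofReal.comp (continuous_truncWeight hα0).measurable).mul
      measurable_enorm).mul hV.enorm
  have hA'm : Measurable A' := ((hm _).mul measurable_enorm).mul hV.enorm
  -- At each point the truncation is eventually inactive, so the sequence is eventually constant and
  -- Fatou's lemma transfers the uniform bound.
  have hlim : ∀ x, Filter.liminf (fun n => A n x ^ 2) Filter.atTop = A' x ^ 2 := fun x => by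
    refine (tendsto_const_nhds.congr' ?_).liminf_eq
    filter_upwards [Filter.eventually_ge_atTop ⌈bracket x⌉₊] with n hn
    have : bracket x ≤ n + 1 := (Nat.le_ceil _).trans ((Nat.cast_le.2 hn).trans (by linarith))
    simp only [hA, hA', truncWeight_of_le this]
  have hA'2 : ∫⁻ x, A' x ^ 2 ≤ B ^ 2 := by
    calc ∫⁻ x, A' x ^ 2 = ∫⁻ x, Filter.liminf (fun n => A n x ^ 2) Filter.atTop := by
          simp only [hlim]
      _ ≤ Filter.liminf (fun n => ∫⁻ x, A n x ^ 2) Filter.atTop :=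
          lintegral_liminf_le fun n => (hAm n).pow_const 2
      _ ≤ B ^ 2 := by
          refine Filter.liminf_le_of_le (by isBoundedDefault) fun b hb => ?_
          obtain ⟨n, hn⟩ := hb.exists
          refine hn.trans ?_
          rw [← l2Norm_sq]
          gcongr
          exact hbd (n + 1) (by simp)
  set g : E → ℝ≥0∞ := fun x => ENNReal.ofReal (bracket x ^ (p + 1)) * ‖V x‖ₑ with hg
  have hgm : Measurable g := (hm _).mul hV.enorm
  have hle : ∫⁻ x, (ENNReal.ofReal (bracket x ^ (p + 1 + α)) * ‖V x‖ₑ) ^ 2 ≤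
      2 * B ^ 2 + 2 * l2Norm volume g ^ 2 := by
    calc _ ≤ ∫⁻ x, (2 * A' x ^ 2 + 2 * g x ^ 2) := by
          refine lintegral_mono fun x => ?_
          -- The energy carries `|x|`, which vanishes at the origin, instead of `⟨x⟩`; the missing
          -- low frequencies are controlled by the norm already known, as `α ≤ 1`.
          have w1 : bracket x ^ (p + 1 + α) ≤ bracket x ^ (p + α) * ‖x‖ + bracket x ^ (p + 1) := by
            have h1 : bracket x ^ (p + 1 + α) = bracket x ^ (p + α) * bracket x := by
              rw [← Real.rpow_add_one (b0 x).ne']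
              ring_nf
            have h2 : bracket x ^ (p + α) ≤ bracket x ^ (p + 1) :=
              Real.rpow_le_rpow_of_exponent_le (one_le_bracket x) (by linarith)
            have h3 : 0 ≤ bracket x ^ (p + α) := (Real.rpow_pos_of_pos (b0 x) _).le
            rw [h1]
            nlinarith [bracket_le_one_add_norm x]
          have w2 : ENNReal.ofReal (bracket x ^ (p + 1 + α)) ≤
              ENNReal.ofReal (bracket x ^ (p + α)) * ‖x‖ₑ + ENNReal.ofReal (bracket x ^ (p + 1)) := by
            have h3 : 0 ≤ bracket x ^ (p + α) := (Real.rpow_pos_of_pos (b0 x) _).le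
            have h4 : 0 ≤ bracket x ^ (p + 1) := (Real.rpow_pos_of_pos (b0 x) _).le
            rw [← ofReal_norm x, ← ENNReal.ofReal_mul h3, ← ENNReal.ofReal_add (by positivity) h4]
            exact ENNReal.ofReal_le_ofReal w1
          calc _ ≤ (A' x + g x) ^ 2 := by
                simp only [hA', hg]
                rw [← add_mul]
                gcongr
            _ ≤ _ := by
                have := ENNReal.rpow_add_le_mul_rpow_add_rpow (A' x) (g x) (p := 2) (by norm_num)
                norm_num at this
                rwa [mul_add] at this
      _ = 2 * (∫⁻ x, A' x ^ 2) + 2 * ∫⁻ x, g x ^ 2 := by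
          rw [lintegral_add_left ((hA'm.pow_const 2).const_mul 2),
            lintegral_const_mul _ (hA'm.pow_const 2), lintegral_const_mul _ (hgm.pow_const 2)]
      _ ≤ _ := by
          rw [l2Norm_sq]
          gcongr
  have : ∫⁻ x, (ENNReal.ofReal (bracket x ^ (p + 1 + α)) * ‖V x‖ₑ) ^ 2 ≠ ∞ :=
    ne_top_of_le_ne_top (by finiteness) hle
  exact ENNReal.rpow_ne_top_of_nonneg (by norm_num) this

end Energy

/-! ### Multiplication as convolution, and positivity of the kernel. -/

section FourierSide

variable {E : Type*} [NormedAddCommGroup E] [InnerProductSpace ℝ E] [FiniteDimensional ℝ E]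
  [MeasurableSpace E] [BorelSpace E]

theorem ae_eq_of_forall_schwartz_integral_eq {f g : E → ℂ} (hf : LocallyIntegrable f)
    (hg : LocallyIntegrable g) (h : ∀ φ : 𝓢(E, ℂ), ∫ x, φ x * f x = ∫ x, φ x * g x) :
    f =ᵐ[volume] g := by
  refine ae_eq_of_integral_contDiff_smul_eq hf hg fun φ hφ hc => ?_
  have h1 : HasCompactSupport (Complex.ofRealCLM ∘ φ) := hc.comp_left rfl
  have h2 : ContDiff ℝ ((⊤ : ℕ∞) : WithTop ℕ∞) (Complex.ofRealCLM ∘ φ) := by fun_prop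
  simpa using h (h1.toSchwartzMap h2)

theorem l2Norm_schwartz_lt_top (ψ : 𝓢(E, ℂ)) : l2Norm volume (fun x => ‖ψ x‖ₑ) < ∞ := by
  rw [l2Norm_enorm]
  exact (ψ.memLp 2 volume).2

theorem lintegral_schwartz_lt_top (ψ : 𝓢(E, ℂ)) : ∫⁻ x, ‖ψ x‖ₑ < ∞ := ψ.integrable.2

theorem l2Norm_lp_lt_top (U : Lp ℂ 2 (volume : Measure E)) :
    l2Norm volume (fun x => ‖U x‖ₑ) < ∞ := by
  rw [l2Norm_enorm]
  exact (Lp.memLp U).2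

theorem measurable_lp (U : Lp ℂ 2 (volume : Measure E)) : Measurable U :=
  (Lp.stronglyMeasurable U).measurable

/-- `𝓕⁻ χ` is the Fourier transform of the reflection of `χ`, so the product is the transform of a
convolution. -/
theorem fourierInv_mul_fourierInv (ψ χ : 𝓢(E, ℂ)) (ζ : E) :
    𝓕⁻ (SchwartzMap.smulLeftCLM ℂ (𝓕 ψ : 𝓢(E, ℂ)) (𝓕⁻ χ)) ζ = ∫ x, ψ x * χ (x - ζ) := by
  let χ' : 𝓢(E, ℂ) := SchwartzMap.compCLMOfContinuousLinearEquiv ℂ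
    (LinearIsometryEquiv.neg ℝ (E := E)).toContinuousLinearEquiv χ
  have hχ' : ∀ x, χ' x = χ (-x) := fun x => rfl
  have h1 : (𝓕⁻ χ : 𝓢(E, ℂ)) = 𝓕 χ' := by
    ext x
    rw [SchwartzMap.fourierInv_coe, SchwartzMap.fourier_coe, Real.fourierInv_eq_fourier_comp_neg]
    rfl
  have h2 : SchwartzMap.smulLeftCLM ℂ (𝓕 ψ : 𝓢(E, ℂ)) (𝓕⁻ χ) =
      𝓕 (SchwartzMap.convolution (ContinuousLinearMap.mul ℂ ℂ) ψ χ') := by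
    rw [SchwartzMap.fourier_convolution, h1]
    ext x
    rw [SchwartzMap.smulLeftCLM_apply_apply (𝓕 ψ : 𝓢(E, ℂ)).hasTemperateGrowth]
    rfl
  rw [h2, fourierInv_fourier_eq, SchwartzMap.convolution_apply, MeasureTheory.convolution]
  refine integral_congr_ae (Filter.Eventually.of_forall fun x => ?_)
  simp [hχ']

theorem integrable_prod_mul {h f g : E → ℂ} (hh : Measurable h) (hf : Measurable f)
    (hg : Measurable g)
    (hfin : ∫⁻ x, ∫⁻ y, ‖h x‖ₑ * ‖f (x - y)‖ₑ * ‖g y‖ₑ ≠ ∞) :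
    Integrable (fun z : E × E => h z.1 * f (z.1 - z.2) * g z.2) (volume.prod volume) := by
  have hm : Measurable fun z : E × E => h z.1 * f (z.1 - z.2) * g z.2 := by fun_prop
  refine ⟨hm.aestronglyMeasurable, ?_⟩
  rw [hasFiniteIntegral_iff_enorm, lintegral_prod _ hm.enorm.aemeasurable]
  simpa only [enorm_mul] using hfin.lt_top

/-- Multiplication by `u` becomes convolution with `𝓕 u` on the Fourier side. -/
theorem integral_fourier_mul_fourierInv_mul (u : Lp ℂ 2 (volume : Measure E)) (ψ χ : 𝓢(E, ℂ)) :
    ∫ x, (𝓕 ψ : 𝓢(E, ℂ)) x * (𝓕⁻ χ : 𝓢(E, ℂ)) x * u x =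
      ∫ y, χ y * ∫ x, ψ x * (𝓕 u : Lp ℂ 2 (volume : Measure E)) (x - y) := by
  set U : Lp ℂ 2 (volume : Measure E) := 𝓕 u
  let ρ : 𝓢(E, ℂ) := SchwartzMap.smulLeftCLM ℂ (𝓕 ψ : 𝓢(E, ℂ)) (𝓕⁻ χ)
  have hρ : ∀ x, ρ x = (𝓕 ψ : 𝓢(E, ℂ)) x * (𝓕⁻ χ : 𝓢(E, ℂ)) x := fun x => by
    simp only [ρ]
    rw [SchwartzMap.smulLeftCLM_apply_apply (𝓕 ψ : 𝓢(E, ℂ)).hasTemperateGrowth]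
    rfl
  have h1 : (u : 𝓢'(E, ℂ)) ρ = (U : 𝓢'(E, ℂ)) (𝓕⁻ ρ) := by
    rw [← Lp.fourier_toTemperedDistribution_eq, TemperedDistribution.fourier_apply, fourier_fourierInv_eq]
  rw [Lp.toTemperedDistribution_apply, Lp.toTemperedDistribution_apply] at h1
  simp only [hρ, smul_eq_mul] at h1
  have hUm := measurable_lp U
  have hψm := ψ.continuous.measurable
  have hχm := χ.continuous.measurable
  have hU2 := (l2Norm_lp_lt_top U).ne
  have hψ2 := (l2Norm_schwartz_lt_top ψ).ne
  have hχ1 := (lintegral_schwartz_lt_top χ).ne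
  have i1 : Integrable (fun z : E × E => ψ z.1 * χ (z.1 - z.2) * U z.2) (volume.prod volume) :=
    integrable_prod_mul hψm hχm hUm (ne_top_of_le_ne_top (by finiteness)
      (lintegral_trilinear_le_mid hψm.enorm hχm.enorm hUm.enorm))
  have i2 : Integrable (fun z : E × E => ψ z.1 * U (z.1 - z.2) * χ z.2) (volume.prod volume) :=
    integrable_prod_mul hψm hUm hχm (ne_top_of_le_ne_top (by finiteness)
      (lintegral_trilinear_le_right hψm.enorm hUm.enorm hχm.enorm))
  rw [h1]
  -- Two applications of Fubini, with the substitution `y ↦ x - y` between them, move the difference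
  -- `x - y` from `χ` to `U`.
  calc _ = ∫ y, ∫ x, ψ x * χ (x - y) * U y := by
        refine integral_congr_ae (Filter.Eventually.of_forall fun y => ?_)
        simp only [ρ]
        rw [fourierInv_mul_fourierInv, integral_mul_const]
    _ = ∫ x, ∫ y, ψ x * χ (x - y) * U y := (integral_integral_swap i1).symm
    _ = ∫ x, ∫ y, ψ x * U (x - y) * χ y := by
        refine integral_congr_ae (Filter.Eventually.of_forall fun x => ?_)
        simp only
        rw [← integral_sub_left_eq_self _ volume x]
        simp only [sub_sub_cancel]
        exact integral_congr_ae (Filter.Eventually.of_forall fun y => by ring)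
    _ = ∫ y, ∫ x, ψ x * U (x - y) * χ y := integral_integral_swap i2
    _ = _ := by
        refine integral_congr_ae (Filter.Eventually.of_forall fun y => ?_)
        simp only
        rw [integral_mul_const, mul_comm]

/-- Parseval for the bilinear pairing, whence `𝓕` on one factor and `𝓕⁻` on the other. Both sides
are continuous in `H`; for Schwartz `H` it is the definition of the transform of a distribution. -/
theorem integral_mul_eq_integral_fourier_mul_fourierInv (G H : Lp ℂ 2 (volume : Measure E)) :
    ∫ x, G x * H x = ∫ x, (𝓕 G : Lp ℂ 2 (volume : Measure E)) x *
      (𝓕⁻ H : Lp ℂ 2 (volume : Measure E)) x := by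
  simp only [integral_mul_eq_inner]
  refine DenseRange.induction_on
    (SchwartzMap.denseRange_toLpCLM (p := 2) ENNReal.ofNat_ne_top) H ?_ ?_
  · have : Continuous fun H : Lp ℂ 2 (volume : Measure E) => (𝓕⁻ H : Lp ℂ 2 (volume : Measure E)) :=
      (Lp.fourierTransformₗᵢ E ℂ).symm.continuous
    exact isClosed_eq (by fun_prop) (by fun_prop)
  intro φ
  rw [SchwartzMap.toLpCLM_apply, SchwartzMap.toLp_fourierInv_eq, ← integral_mul_eq_inner,
    ← integral_mul_eq_inner]
  have h1 : (G : 𝓢'(E, ℂ)) φ = ((𝓕 G : Lp ℂ 2 (volume : Measure E)) : 𝓢'(E, ℂ)) (𝓕⁻ φ) := by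
    rw [← Lp.fourier_toTemperedDistribution_eq, TemperedDistribution.fourier_apply, fourier_fourierInv_eq]
  rw [Lp.toTemperedDistribution_apply, Lp.toTemperedDistribution_apply] at h1
  have e : ∀ (K : Lp ℂ 2 (volume : Measure E)) (χ : 𝓢(E, ℂ)),
      ∫ x, K x * (χ.toLp 2 : Lp ℂ 2 (volume : Measure E)) x = ∫ x, χ x • K x := fun K χ => by
    refine integral_congr_ae ?_
    filter_upwards [χ.coeFn_toLp 2 volume] with x hx
    rw [hx, smul_eq_mul, mul_comm]
  rw [e, e, h1]

open ComplexConjugate in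
-- As `𝓕 (conj χ) = conj (𝓕⁻ χ)`, the form equals `∫ |𝓕⁻ χ|² c`.
theorem integral_conj_mul_kernel_nonneg_schwartz (u : Lp ℂ 2 (volume : Measure E)) {c : E → ℝ}
    (hc : ∀ᵐ x, 0 ≤ c x) (hu : ∀ᵐ x, u x = c x) (χ : 𝓢(E, ℂ)) :
    0 ≤ (∫ y, χ y * ∫ x, conj (χ x) *
      (𝓕 u : Lp ℂ 2 (volume : Measure E)) (x - y)).re := by
  let ψ : 𝓢(E, ℂ) := SchwartzMap.postcompCLM (𝕜 := ℝ) (Complex.conjCLE : ℂ →L[ℝ] ℂ) χ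
  have hψ : ∀ x, ψ x = conj (χ x) := fun x => rfl
  have h1 : ∀ x, (𝓕 ψ : 𝓢(E, ℂ)) x = conj ((𝓕⁻ χ : 𝓢(E, ℂ)) x) := fun x => by
    rw [SchwartzMap.fourierInv_coe, SchwartzMap.fourier_coe, Real.fourierInv_eq', Real.fourier_eq',
      ← integral_conj]
    refine integral_congr_ae (Filter.Eventually.of_forall fun y => ?_)
    simp only [smul_eq_mul, map_mul, hψ, ← Complex.exp_conj, Complex.conj_ofReal, Complex.conj_I]
    congr 2
    push_cast
    ring
  have h2 := integral_fourier_mul_fourierInv_mul u ψ χ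
  simp only [hψ] at h2
  rw [← h2]
  have h3 : ∫ x, (𝓕 ψ : 𝓢(E, ℂ)) x * (𝓕⁻ χ : 𝓢(E, ℂ)) x * u x =
      ∫ x, ((‖(𝓕⁻ χ : 𝓢(E, ℂ)) x‖ ^ 2 * c x : ℝ) : ℂ) := by
    refine integral_congr_ae ?_
    filter_upwards [hu] with x hx
    rw [h1, Complex.conj_mul', hx]
    push_cast
    rfl
  rw [h3, integral_complex_ofReal, Complex.ofReal_re]
  refine integral_nonneg_of_ae ?_
  filter_upwards [hc] with x hx
  positivity

open ComplexConjugate in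
-- An integrable kernel gives a bounded form on `L²`; this is what extends positivity from Schwartz
-- functions by density.
theorem integrable_and_norm_integral_conj_mul_kernel_le {k f g : E → ℂ} (hk : Measurable k) (hf : Measurable f)
    (hg : Measurable g) (hk1 : ∫⁻ x, ‖k x‖ₑ ≠ ∞) (hf2 : MemLp f 2) (hg2 : MemLp g 2) :
    Integrable (fun z : E × E => conj (f z.1) * k (z.1 - z.2) * g z.2) (volume.prod volume) ∧
    ‖∫ z : E × E, conj (f z.1) * k (z.1 - z.2) * g z.2 ∂(volume.prod volume)‖ ≤
      (∫⁻ x, ‖k x‖ₑ).toReal * (eLpNorm f 2).toReal * (eLpNorm g 2).toReal := by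
  have hm : Measurable fun z : E × E => conj (f z.1) * k (z.1 - z.2) * g z.2 := by fun_prop
  have hle : ∫⁻ z : E × E, ‖conj (f z.1) * k (z.1 - z.2) * g z.2‖ₑ ∂(volume.prod volume) ≤
      eLpNorm f 2 * eLpNorm g 2 * ∫⁻ x, ‖k x‖ₑ := by
    rw [lintegral_prod _ hm.enorm.aemeasurable, ← l2Norm_enorm, ← l2Norm_enorm]
    simp only [enorm_mul, RCLike.enorm_conj]
    exact lintegral_trilinear_le_mid hf.enorm hk.enorm hg.enorm
  have hfin : eLpNorm f 2 * eLpNorm g 2 * ∫⁻ x, ‖k x‖ₑ ≠ ∞ := by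
    have := hf2.2.ne
    have := hg2.2.ne
    finiteness
  refine ⟨⟨hm.aestronglyMeasurable, hle.trans_lt hfin.lt_top⟩, ?_⟩
  have := ENNReal.toReal_mono hfin ((enorm_integral_le_lintegral_enorm _).trans hle)
  rw [toReal_enorm, ENNReal.toReal_mul, ENNReal.toReal_mul] at this
  exact this.trans_eq (by ring)

open ComplexConjugate in
/-- Convolution with the Fourier transform of a nonnegative function is a positive operator. -/
theorem integral_conj_mul_kernel_nonneg (u : Lp ℂ 2 (volume : Measure E)) {c : E → ℝ}
    (hc : ∀ᵐ x, 0 ≤ c x) (hu : ∀ᵐ x, u x = c x)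
    (hk1 : ∫⁻ x, ‖(𝓕 u : Lp ℂ 2 (volume : Measure E)) x‖ₑ ≠ ∞) {h : E → ℂ} (hm : Measurable h)
    (h2 : MemLp h 2) :
    0 ≤ (∫ z : E × E, conj (h z.1) * (𝓕 u : Lp ℂ 2 (volume : Measure E)) (z.1 - z.2) * h z.2
      ∂(volume.prod volume)).re := by
  set k : E → ℂ := ⇑(𝓕 u : Lp ℂ 2 (volume : Measure E))
  have hk : Measurable k := measurable_lp _
  set K := (∫⁻ x, ‖k x‖ₑ).toReal
  set N := (eLpNorm h 2).toReal
  have hK : 0 ≤ K := ENNReal.toReal_nonneg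
  have hN : 0 ≤ N := ENNReal.toReal_nonneg
  by_contra! hneg
  set q : ℂ := ∫ z : E × E, conj (h z.1) * k (z.1 - z.2) * h z.2 ∂(volume.prod volume) with hq
  -- Replacing `h` by a Schwartz function within `e` changes the form by at most `K e N + K (N + 1)
  -- e`, where `e ≤ 1` bounds the norm of the approximant by `N + 1`. This is to stay below `-Re q`.
  -- The final `+ 1` in the denominator keeps it positive when `K = 0`.
  obtain ⟨e, he0, he1, he2⟩ : ∃ e : ℝ, 0 < e ∧ e ≤ 1 ∧ K * e * (2 * N + 1) < -q.re := by
    refine ⟨min 1 (-q.re / (2 * (K * (2 * N + 1) + 1))), ?_, min_le_left _ _, ?_⟩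
    · have : 0 < -q.re := by linarith
      positivity
    · have hM : 0 ≤ K * (2 * N + 1) := by positivity
      calc K * min 1 (-q.re / (2 * (K * (2 * N + 1) + 1))) * (2 * N + 1) ≤
            K * (-q.re / (2 * (K * (2 * N + 1) + 1))) * (2 * N + 1) := by
            gcongr
            exact min_le_right _ _
        _ = (K * (2 * N + 1)) / (2 * (K * (2 * N + 1) + 1)) * (-q.re) := by ring
        _ < 1 * (-q.re) := by
            gcongr
            · linarith
            · rw [div_lt_one (by positivity)]
              linarith
        _ = _ := one_mul _
  obtain ⟨φ, hφ⟩ := (SchwartzMap.denseRange_toLpCLM (E := E) (F := ℂ) (μ := volume) (p := 2)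
    ENNReal.ofNat_ne_top).exists_dist_lt (h2.toLp h) he0
  have hφm : Measurable ⇑φ := φ.continuous.measurable
  have hφ2 : MemLp (⇑φ) 2 := φ.memLp 2 volume
  have hd2 : MemLp (h - ⇑φ) 2 := h2.sub hφ2
  have hdm : Measurable (h - ⇑φ) := hm.sub hφm
  have hde : (eLpNorm (h - ⇑φ) 2).toReal ≤ e := by
    rw [dist_eq_norm, SchwartzMap.toLpCLM_apply] at hφ
    have : h2.toLp h - (φ.toLp 2 : Lp ℂ 2 (volume : Measure E)) = hd2.toLp (h - ⇑φ) := (MemLp.toLp_sub h2 hφ2).symm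
    rw [this, Lp.norm_toLp] at hφ
    exact hφ.le
  have hφN : (eLpNorm (⇑φ) 2).toReal ≤ N + 1 := by
    have h4 : eLpNorm (⇑φ) 2 ≤ eLpNorm h 2 + eLpNorm (h - ⇑φ) 2 := by
      have := eLpNorm_sub_le h2.1 hd2.1 (p := 2) (by norm_num)
      simpa using this
    have h5 := ENNReal.toReal_mono (by have := h2.2.ne; have := hd2.2.ne; finiteness) h4
    rw [ENNReal.toReal_add h2.2.ne hd2.2.ne] at h5
    linarith
  obtain ⟨i1, b1⟩ := integrable_and_norm_integral_conj_mul_kernel_le hk hdm hm hk1 hd2 h2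
  obtain ⟨i2, b2⟩ := integrable_and_norm_integral_conj_mul_kernel_le hk hφm hdm hk1 hφ2 hd2
  obtain ⟨i3, -⟩ := integrable_and_norm_integral_conj_mul_kernel_le hk hφm hφm hk1 hφ2 hφ2
  have hsplit : q = (∫ z : E × E, conj (φ z.1) * k (z.1 - z.2) * φ z.2 ∂(volume.prod volume)) +
      (∫ z : E × E, conj ((h - ⇑φ) z.1) * k (z.1 - z.2) * h z.2 ∂(volume.prod volume)) +
      ∫ z : E × E, conj (φ z.1) * k (z.1 - z.2) * (h - ⇑φ) z.2 ∂(volume.prod volume) := by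
    have i4 : Integrable (fun z : E × E => conj (φ z.1) * k (z.1 - z.2) * φ z.2 +
      conj ((h - ⇑φ) z.1) * k (z.1 - z.2) * h z.2) (volume.prod volume) := i3.add i1
    rw [← integral_add i3 i1, ← integral_add i4 i2]
    refine integral_congr_ae (Filter.Eventually.of_forall fun z => ?_)
    simp only [Pi.sub_apply, map_sub]
    ring
  have hφpos : 0 ≤ (∫ z : E × E, conj (φ z.1) * k (z.1 - z.2) * φ z.2 ∂(volume.prod volume)).re := by
    have := integral_conj_mul_kernel_nonneg_schwartz u hc hu φ
    rw [integral_prod_symm _ i3]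
    convert this using 3
    funext y
    rw [mul_comm]
    exact integral_mul_const (φ y) fun x => conj (φ x) * k (x - y)
  have r1 := (abs_le.1 (Complex.abs_re_le_norm
    (∫ z : E × E, conj ((h - ⇑φ) z.1) * k (z.1 - z.2) * h z.2 ∂(volume.prod volume)))).1
  have r2 := (abs_le.1 (Complex.abs_re_le_norm
    (∫ z : E × E, conj (φ z.1) * k (z.1 - z.2) * (h - ⇑φ) z.2 ∂(volume.prod volume)))).1
  have hre := congrArg Complex.re hsplit
  simp only [Complex.add_re] at hre
  have c1 : K * (eLpNorm (h - ⇑φ) 2).toReal * N ≤ K * e * N := by gcongr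
  have c2 : K * (eLpNorm (⇑φ) 2).toReal * (eLpNorm (h - ⇑φ) 2).toReal ≤ K * (N + 1) * e := by gcongr
  have c3 : K * e * N + K * (N + 1) * e = K * e * (2 * N + 1) := by ring
  linarith

end FourierSide

/-! ### Sobolev norms and the duality product on the Fourier side. -/

section SobolevSide

variable {E : Type*} [NormedAddCommGroup E] [InnerProductSpace ℝ E] [FiniteDimensional ℝ E]
  [MeasurableSpace E] [BorelSpace E]

theorem locallyIntegrable_continuous_mul_lp {g : E → ℂ} (hg : Continuous g)
    (U : Lp ℂ 2 (volume : Measure E)) : LocallyIntegrable (fun x => g x * U x) := by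
  have hU : LocallyIntegrable U := (Lp.memLp U).locallyIntegrable (by norm_num)
  rw [← locallyIntegrableOn_univ] at hU ⊢
  exact hU.continuousOn_mul hg.continuousOn isOpen_univ.isLocallyClosed

/-- Passes from multiplication of distributions to pointwise multiplication of functions; both
products are locally integrable, so Schwartz functions separate them. -/
theorem smulLeftCLM_lp_eq_iff {g : E → ℂ} (hg : g.HasTemperateGrowth)
    (U W : Lp ℂ 2 (volume : Measure E)) :
    smulLeftCLM ℂ g (U : 𝓢'(E, ℂ)) = (W : 𝓢'(E, ℂ)) ↔ W =ᵐ[volume] fun x => g x * U x := by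
  have e : ∀ φ : 𝓢(E, ℂ), smulLeftCLM ℂ g (U : 𝓢'(E, ℂ)) φ = ∫ x, φ x * (g x * U x) := fun φ => by
    rw [smulLeftCLM_apply_apply, Lp.toTemperedDistribution_apply]
    refine integral_congr_ae (Filter.Eventually.of_forall fun x => ?_)
    simp only [SchwartzMap.smulLeftCLM_apply_apply hg, smul_eq_mul]
    ring
  constructor
  · intro h
    refine ae_eq_of_forall_schwartz_integral_eq ((Lp.memLp W).locallyIntegrable (by norm_num))
      (locallyIntegrable_continuous_mul_lp hg.1.continuous U) fun φ => ?_
    rw [← e, h, Lp.toTemperedDistribution_apply]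
    rfl
  · intro h
    ext φ
    rw [e, Lp.toTemperedDistribution_apply]
    refine integral_congr_ae ?_
    filter_upwards [h] with x hx
    rw [hx, smul_eq_mul]

theorem memSobolev_iff_l2Norm_ne_top {t : ℝ} {T : 𝓢'(E, ℂ)} {U : Lp ℂ 2 (volume : Measure E)}
    (hT : 𝓕 T = (U : 𝓢'(E, ℂ))) : MemSobolev t 2 T ↔
      l2Norm volume (fun x => ENNReal.ofReal (bracket x ^ t) * ‖U x‖ₑ) ≠ ∞ := by
  have hw : (fun x : E => Complex.ofReal ((1 + ‖x‖ ^ 2) ^ (t / 2))).HasTemperateGrowth := by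
    fun_prop
  have hn : ∀ x : E, ‖Complex.ofReal ((1 + ‖x‖ ^ 2) ^ (t / 2)) * U x‖ₑ =
      ENNReal.ofReal (bracket x ^ t) * ‖U x‖ₑ := fun x => by
    rw [enorm_mul, bracket_rpow, ← ofReal_norm, Complex.norm_real, Real.norm_of_nonneg (by positivity)]
  rw [memSobolev_iff_exists_smulLeftCLM_fourier, hT]
  simp only [smulLeftCLM_lp_eq_iff hw, ← hn, l2Norm_enorm]
  constructor
  · rintro ⟨W, hW⟩
    rw [← eLpNorm_congr_ae hW]
    exact (Lp.memLp W).2.ne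
  · intro h
    have hm : MemLp (fun x => Complex.ofReal ((1 + ‖x‖ ^ 2) ^ (t / 2)) * U x) 2 := by
      refine ⟨?_, h.lt_top⟩
      have := measurable_lp U
      have := hw.1.continuous.measurable
      exact (this.mul (measurable_lp U)).aestronglyMeasurable
    exact ⟨hm.toLp _, hm.coeFn_toLp⟩

theorem measurable_integral_schwartz_mul (ψ : 𝓢(E, ℂ)) (U : Lp ℂ 2 (volume : Measure E)) :
    StronglyMeasurable fun y => ∫ x, ψ x * U (x - y) := by
  have hU := measurable_lp U
  have hψ := ψ.continuous.measurable
  have : StronglyMeasurable fun z : E × E => ψ z.2 * U (z.2 - z.1) :=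
    Measurable.stronglyMeasurable (by fun_prop)
  exact this.integral_prod_right

theorem norm_integral_schwartz_mul_le (ψ : 𝓢(E, ℂ)) (U : Lp ℂ 2 (volume : Measure E)) (y : E) :
    ‖∫ x, ψ x * U (x - y)‖ ≤
      (l2Norm volume (fun x => ‖ψ x‖ₑ) * l2Norm volume (fun x => ‖U x‖ₑ)).toReal := by
  have h1 := (l2Norm_schwartz_lt_top ψ).ne
  have h2 := (l2Norm_lp_lt_top U).ne
  have hU := measurable_lp U
  rw [← toReal_enorm]
  refine ENNReal.toReal_mono (by finiteness) ?_
  refine (enorm_integral_le_lintegral_enorm _).trans ?_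
  simp only [enorm_mul]
  refine (lintegral_mul_le_l2Norm (g := fun x => ‖U (x - y)‖ₑ) ψ.continuous.measurable.enorm
    (by fun_prop)).trans_eq ?_
  rw [l2Norm_sub_right (fun x => ‖U x‖ₑ)]

/-- The duality product of `c₀ + c₁` with a derivative of a square integrable function, on the
Fourier side. -/
theorem dualityProduct_lineDeriv_fourier (c₀ : ℝ) {c₁ : Lp ℂ 2 (volume : Measure E)}
    (hc₁ : MemSobolev 1 2 (c₁ : 𝓢'(E, ℂ))) {v : 𝓢'(E, ℂ)} {V : Lp ℂ 2 (volume : Measure E)}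
    (hv : 𝓕 v = (V : 𝓢'(E, ℂ))) (m : E) (ψ : 𝓢(E, ℂ)) :
    dualityProduct (coeffDistribution c₀ c₁) (∂_{m} v) (𝓕 ψ) =
      ∫ y, (2 * Real.pi * Complex.I * (inner ℝ y m : ℝ) * V y) *
        (c₀ * ψ y + ∫ x, ψ x * (𝓕 c₁ : Lp ℂ 2 (volume : Measure E)) (x - y)) := by
  set k : Lp ℂ 2 (volume : Measure E) := 𝓕 c₁
  have hv0 : MemSobolev 0 2 v := memSobolev_zero_iff_exists_fourier.2 ⟨V, hv⟩
  have hg : MemSobolev (-1) 2 (∂_{m} v) := by simpa using hv0.lineDerivOp (m := m)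
  obtain ⟨G, hG, hw⟩ := isDualityProduct_dualityProduct (c₀ : ℂ) hc₁ hg
  obtain ⟨Ψ, hΨ, hwφ⟩ := hw (𝓕 ψ)
  change dualityProduct (coeffDistribution c₀ c₁) (∂_{m} v) (𝓕 ψ) = _ at hwφ
  change besselPotential E ℂ 1 (smulLeftCLM ℂ _ (coeffDistribution c₀ c₁)) = _ at hΨ
  rw [hwφ, integral_mul_eq_integral_fourier_mul_fourierInv]
  have hw1 : (fun x : E => Complex.ofReal ((1 + ‖x‖ ^ 2) ^ ((1 : ℝ) / 2))).HasTemperateGrowth := by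
    fun_prop
  have hwm : (fun x : E => Complex.ofReal ((1 + ‖x‖ ^ 2) ^ ((-1 : ℝ) / 2))).HasTemperateGrowth := by
    fun_prop
  have hi : (fun x : E => ((inner ℝ x m : ℝ) : ℂ)).HasTemperateGrowth := by fun_prop
  -- The transform of `J⁻¹ ∂_m v`: the derivative contributes `2πi (x·m)` and the Bessel potential
  -- `⟨x⟩⁻¹`.
  have hGf : (𝓕 G : Lp ℂ 2 (volume : Measure E)) =ᵐ[volume] fun x =>
      (2 * Real.pi * Complex.I) • (fun x : E => ((inner ℝ x m : ℝ) : ℂ)) x *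
        Complex.ofReal ((1 + ‖x‖ ^ 2) ^ ((-1 : ℝ) / 2)) * V x := by
    have hd := congrArg (fun T : 𝓢'(E, ℂ) => 𝓕 T) hG
    have hi' : ((2 * Real.pi * Complex.I) • fun x : E => ((inner ℝ x m : ℝ) : ℂ)).HasTemperateGrowth :=
      (Function.HasTemperateGrowth.const (2 * Real.pi * Complex.I)).mul hi
    simp only [fourier_besselPotential_eq_smulLeftCLM_fourier_apply,
      TemperedDistribution.fourier_lineDerivOp_eq, hv, Lp.fourier_toTemperedDistribution_eq] at hd
    rw [← smul_apply, ← smulLeftCLM_smul hi, smulLeftCLM_smulLeftCLM_apply hi' hwm,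
      smulLeftCLM_lp_eq_iff (hi'.mul hwm)] at hd
    exact hd
  -- The inverse transform of `J ((𝓕 ψ) c)`: a weight `⟨y⟩` times `c₀ ψ` plus the convolution
  -- integral coming from `c₁`. The identity is obtained by testing against `χ`, with the weight
  -- moved onto `χ`.
  have hΨf : (𝓕⁻ Ψ : Lp ℂ 2 (volume : Measure E)) =ᵐ[volume] fun y =>
      Complex.ofReal ((1 + ‖y‖ ^ 2) ^ ((1 : ℝ) / 2)) * (c₀ * ψ y + ∫ x, ψ x * k (x - y)) := by
    refine ae_eq_of_forall_schwartz_integral_eq ((Lp.memLp _).locallyIntegrable (by norm_num))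
      ?_ fun χ => ?_
    · have h1 : LocallyIntegrable fun y => c₀ * ψ y + ∫ x, ψ x * k (x - y) := by
        refine LocallyIntegrable.add (Continuous.locallyIntegrable (by fun_prop)) ?_
        refine (locallyIntegrable_const (l2Norm volume (fun x => ‖ψ x‖ₑ) *
          l2Norm volume (fun x => ‖k x‖ₑ)).toReal).mono
          (measurable_integral_schwartz_mul ψ k).aestronglyMeasurable
          (Filter.Eventually.of_forall fun y => ?_)
        exact (norm_integral_schwartz_mul_le ψ k y).trans (le_abs_self _)
      rw [← locallyIntegrableOn_univ] at h1 ⊢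
      exact h1.continuousOn_mul hw1.1.continuous.continuousOn isOpen_univ.isLocallyClosed
    have h1 : ((𝓕⁻ Ψ : Lp ℂ 2 (volume : Measure E)) : 𝓢'(E, ℂ)) χ =
      coeffDistribution c₀ c₁ (SchwartzMap.smulLeftCLM ℂ (𝓕 ψ : 𝓢(E, ℂ)) (𝓕⁻ (SchwartzMap.smulLeftCLM ℂ
        (fun x : E => Complex.ofReal ((1 + ‖x‖ ^ 2) ^ ((1 : ℝ) / 2))) χ))) := by
      rw [← Lp.fourierInv_toTemperedDistribution_eq, fourierInv_apply, ← hΨ, besselPotential,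
        TemperedDistribution.fourierMultiplierCLM_apply_apply,
        schwartz_multiplier_reflect hw1 (by simpa only [norm_neg] using hw1),
        SchwartzMap.fourierMultiplierCLM_apply, fourier_fourierInv_eq]
      simp only [norm_neg]
      rfl
    set χ' : 𝓢(E, ℂ) := SchwartzMap.smulLeftCLM ℂ
        (fun x : E => Complex.ofReal ((1 + ‖x‖ ^ 2) ^ ((1 : ℝ) / 2))) χ with hχ'
    have hχe : ∀ y, χ' y = Complex.ofReal ((1 + ‖y‖ ^ 2) ^ ((1 : ℝ) / 2)) * χ y := fun y => by
      rw [hχ', SchwartzMap.smulLeftCLM_apply_apply hw1, smul_eq_mul]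
    have hρ : ∀ x, SchwartzMap.smulLeftCLM ℂ (𝓕 ψ : 𝓢(E, ℂ)) (𝓕⁻ χ') x =
        (𝓕 ψ : 𝓢(E, ℂ)) x * (𝓕⁻ χ' : 𝓢(E, ℂ)) x := fun x => by
      rw [SchwartzMap.smulLeftCLM_apply_apply (𝓕 ψ : 𝓢(E, ℂ)).hasTemperateGrowth, smul_eq_mul]
    have h2 : ∫ x, (𝓕 ψ : 𝓢(E, ℂ)) x * (𝓕⁻ χ' : 𝓢(E, ℂ)) x = ∫ y, χ' y * ψ y := by
      rw [SchwartzMap.integral_fourier_mul_eq, fourier_fourierInv_eq]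
      simp only [mul_comm]
    have hρi : Integrable fun x => (𝓕 ψ : 𝓢(E, ℂ)) x * (𝓕⁻ χ' : 𝓢(E, ℂ)) x :=
      ((SchwartzMap.smulLeftCLM ℂ (𝓕 ψ : 𝓢(E, ℂ)) (𝓕⁻ χ')).integrable (μ := volume)).congr
        (Filter.Eventually.of_forall hρ)
    have hρ2 : Integrable fun x => (𝓕 ψ : 𝓢(E, ℂ)) x * (𝓕⁻ χ' : 𝓢(E, ℂ)) x * c₁ x :=
      (((SchwartzMap.smulLeftCLM ℂ (𝓕 ψ : 𝓢(E, ℂ)) (𝓕⁻ χ')).memLp 2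
        volume).integrable_mul (Lp.memLp c₁)).congr
        (Filter.Eventually.of_forall fun x => congrArg (· * c₁ x) (hρ x))
    have hχψ : Integrable fun y => χ' y * ψ y :=
      (χ'.memLp 2 volume).integrable_mul (ψ.memLp 2 volume)
    have hχk : Integrable fun y => χ' y * ∫ x, ψ x * k (x - y) :=
      χ'.integrable.mul_bdd (measurable_integral_schwartz_mul ψ k).aestronglyMeasurable
        (Filter.Eventually.of_forall (norm_integral_schwartz_mul_le ψ k))
    rw [Lp.toTemperedDistribution_apply, coeffDistribution_apply] at h1
    simp only [hρ, smul_eq_mul, mul_add] at h1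
    rw [h1, integral_add (hρi.mul_const _) hρ2, integral_mul_const, h2,
      integral_fourier_mul_fourierInv_mul, ← integral_mul_const,
      ← integral_add (hχψ.mul_const _) hχk]
    refine integral_congr_ae (Filter.Eventually.of_forall fun y => ?_)
    simp only [hχe]
    ring
  refine integral_congr_ae ?_
  filter_upwards [hGf, hΨf] with y h1 h2
  rw [h1, h2]
  -- The weights of `J⁻¹` and `J` cancel, so no Bessel potential remains in the formula.
  have h3 : Complex.ofReal ((1 + ‖y‖ ^ 2) ^ ((-1 : ℝ) / 2)) *
      Complex.ofReal ((1 + ‖y‖ ^ 2) ^ ((1 : ℝ) / 2)) = 1 := by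
    rw [← Complex.ofReal_mul, ← Real.rpow_add (by positivity)]
    norm_num
  simp only [smul_eq_mul]
  linear_combination (2 * Real.pi * Complex.I * (inner ℝ y m : ℝ) * V y *
    (c₀ * ψ y + ∫ x, ψ x * k (x - y))) * h3

end SobolevSide

/-! ### The equation on the Fourier side. -/

section Equation

theorem enorm_le_bracket_mul {E : Type*} [NormedAddCommGroup E] (x y : E) :
    ‖y‖ₑ ≤ ENNReal.ofReal (2 * bracket x) * ENNReal.ofReal (bracket (x - y)) := by
  have hx := one_le_bracket x
  have hd := one_le_bracket (x - y)
  rw [← ofReal_norm, ← ENNReal.ofReal_mul (by positivity)]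
  refine ENNReal.ofReal_le_ofReal ?_
  have h1 := bracket_le_bracket_add y x
  rw [← bracket_neg (y - x), neg_sub] at h1
  nlinarith [norm_le_bracket y]

variable {E : Type*} [NormedAddCommGroup E] [InnerProductSpace ℝ E] [FiniteDimensional ℝ E]
  [MeasurableSpace E] [BorelSpace E]

/-- The unbounded factor `|y|` is split by `|y| ≤ 2⟨x⟩⟨x-y⟩`: the part `⟨x-y⟩` is paid for by one
derivative of `c₁`, the part `⟨x⟩` is left for the test function. -/
theorem lintegral_kernel_le {k V : E → ℂ} (hk : Measurable k) (hV : Measurable V) (x : E) :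
    ∫⁻ y, ‖k (x - y)‖ₑ * ‖y‖ₑ * ‖V y‖ₑ ≤ ENNReal.ofReal (2 * bracket x) *
      (l2Norm volume (fun x => ENNReal.ofReal (bracket x) * ‖k x‖ₑ) *
        l2Norm volume (fun x => ‖V x‖ₑ)) := by
  have hb : Measurable fun x : E => ENNReal.ofReal (bracket x) :=
    ENNReal.measurable_ofReal.comp continuous_bracket.measurable
  rw [← l2Norm_sub_left (fun x => ENNReal.ofReal (bracket x) * ‖k x‖ₑ) x]
  refine le_trans ?_ (mul_le_mul_right (lintegral_mul_le_l2Norm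
    (f := fun y => ENNReal.ofReal (bracket (x - y)) * ‖k (x - y)‖ₑ) (by fun_prop) hV.enorm) _)
  rw [← lintegral_const_mul' _ _ ENNReal.ofReal_ne_top]
  refine lintegral_mono fun y => ?_
  calc _ ≤ ‖k (x - y)‖ₑ * (ENNReal.ofReal (2 * bracket x) * ENNReal.ofReal (bracket (x - y))) *
        ‖V y‖ₑ := by
        gcongr
        exact enorm_le_bracket_mul x y
    _ = _ := by ring

theorem lintegral_norm_mul_bracket_mul_schwartz_lt_top (ψ : 𝓢(E, ℂ)) :
    ∫⁻ x, ‖ψ x‖ₑ * ‖x‖ₑ * ENNReal.ofReal (2 * bracket x) < ∞ := by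
  have hg : (fun x : E => Complex.ofReal (2 * (1 + ‖x‖ ^ 2))).HasTemperateGrowth := by fun_prop
  refine lt_of_le_of_lt (lintegral_mono fun x => ?_) (lintegral_schwartz_lt_top
    (SchwartzMap.smulLeftCLM ℂ (fun x : E => Complex.ofReal (2 * (1 + ‖x‖ ^ 2))) ψ))
  rw [SchwartzMap.smulLeftCLM_apply_apply hg, smul_eq_mul, enorm_mul, mul_assoc, mul_comm]
  gcongr
  rw [← ofReal_norm x, ← ENNReal.ofReal_mul (norm_nonneg x), ← ofReal_norm, Complex.norm_real,
    Real.norm_of_nonneg (by positivity), ← bracket_sq]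
  refine ENNReal.ofReal_le_ofReal ?_
  nlinarith [norm_le_bracket x, bracket_pos x]

/-- Absolute convergence of the paired kernel. -/
theorem integrable_schwartz_kernel (ψ : 𝓢(E, ℂ)) {k V : E → ℂ} (hk : Measurable k)
    (hV : Measurable V) (hk2 : l2Norm volume (fun x => ENNReal.ofReal (bracket x) * ‖k x‖ₑ) ≠ ∞)
    (hV2 : l2Norm volume (fun x => ‖V x‖ₑ) ≠ ∞) {B : E → E → ℝ}
    (hBm : Measurable fun z : E × E => B z.1 z.2) (hB : ∀ x y, |B x y| ≤ ‖x‖ * ‖y‖) :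
    Integrable (fun z : E × E => ψ z.1 * (k (z.1 - z.2) * B z.1 z.2 * V z.2))
      (volume.prod volume) := by
  have hψ := ψ.continuous.measurable
  have hm : Measurable fun z : E × E => ψ z.1 * (k (z.1 - z.2) * B z.1 z.2 * V z.2) := by fun_prop
  have hBe : ∀ x y, ‖(B x y : ℂ)‖ₑ ≤ ‖x‖ₑ * ‖y‖ₑ := fun x y => by
    rw [← ofReal_norm, Complex.norm_real, ← ofReal_norm x, ← ofReal_norm y,
      ← ENNReal.ofReal_mul (norm_nonneg _)]
    exact ENNReal.ofReal_le_ofReal (hB x y)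
  refine ⟨hm.aestronglyMeasurable, ?_⟩
  rw [hasFiniteIntegral_iff_enorm, lintegral_prod _ hm.enorm.aemeasurable]
  have hψ1 := lintegral_norm_mul_bracket_mul_schwartz_lt_top ψ
  calc ∫⁻ x, ∫⁻ y, ‖ψ x * (k (x - y) * B x y * V y)‖ₑ ≤
        ∫⁻ x, (‖ψ x‖ₑ * ‖x‖ₑ * ENNReal.ofReal (2 * bracket x)) *
          (l2Norm volume (fun x => ENNReal.ofReal (bracket x) * ‖k x‖ₑ) *
            l2Norm volume (fun x => ‖V x‖ₑ)) := by
        refine lintegral_mono fun x => ?_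
        rw [mul_assoc (‖ψ x‖ₑ * ‖x‖ₑ)]
        refine le_trans ?_ (mul_le_mul_right (lintegral_kernel_le hk hV x) _)
        rw [← lintegral_const_mul' _ _ (by finiteness)]
        refine lintegral_mono fun y => ?_
        simp only [enorm_mul]
        calc _ ≤ ‖ψ x‖ₑ * (‖k (x - y)‖ₑ * (‖x‖ₑ * ‖y‖ₑ) * ‖V y‖ₑ) := by
              gcongr
              exact hBe x y
          _ = _ := by ring
    _ = _ := lintegral_mul_const' _ _ (by finiteness)
    _ < ∞ := by
        have := hψ1.ne
        finiteness

theorem locallyIntegrable_kernel {k V : E → ℂ} (hk : Measurable k) (hV : Measurable V)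
    (hk2 : l2Norm volume (fun x => ENNReal.ofReal (bracket x) * ‖k x‖ₑ) ≠ ∞)
    (hV2 : l2Norm volume (fun x => ‖V x‖ₑ) ≠ ∞) :
    LocallyIntegrable fun x => ∫ y, k (x - y) * (inner ℝ x y : ℝ) * V y := by
  have hm : StronglyMeasurable fun z : E × E => k (z.1 - z.2) * (inner ℝ z.1 z.2 : ℝ) * V z.2 :=
    Measurable.stronglyMeasurable (by fun_prop)
  set N := l2Norm volume (fun x => ENNReal.ofReal (bracket x) * ‖k x‖ₑ) *
        l2Norm volume (fun x => ‖V x‖ₑ) with hN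
  have hc : Continuous fun x : E => ‖x‖ * (2 * bracket x * N.toReal) := by fun_prop
  refine hc.locallyIntegrable.mono hm.integral_prod_right.aestronglyMeasurable
    (Filter.Eventually.of_forall fun x => ?_)
  have hNt : N ≠ ∞ := by finiteness
  have h1 : ‖∫ y, k (x - y) * (inner ℝ x y : ℝ) * V y‖ₑ ≤
      ‖x‖ₑ * (ENNReal.ofReal (2 * bracket x) * N) := by
    refine (enorm_integral_le_lintegral_enorm _).trans ?_
    refine le_trans ?_ (mul_le_mul_right (lintegral_kernel_le hk hV x) _)
    rw [← lintegral_const_mul' _ _ (by finiteness)]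
    refine lintegral_mono fun y => ?_
    have hi : ‖((inner ℝ x y : ℝ) : ℂ)‖ₑ ≤ ‖x‖ₑ * ‖y‖ₑ := by
      rw [← ofReal_norm, Complex.norm_real, ← ofReal_norm x, ← ofReal_norm y,
        ← ENNReal.ofReal_mul (norm_nonneg _)]
      exact ENNReal.ofReal_le_ofReal (norm_inner_le_norm x y)
    simp only [enorm_mul]
    calc _ ≤ ‖k (x - y)‖ₑ * (‖x‖ₑ * ‖y‖ₑ) * ‖V y‖ₑ := by gcongr
      _ = _ := by ring
  have h2 := ENNReal.toReal_mono (by finiteness) h1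
  have hb := bracket_pos x
  rw [toReal_enorm, ENNReal.toReal_mul, ENNReal.toReal_mul, toReal_enorm,
    ENNReal.toReal_ofReal (by positivity)] at h2
  exact h2.trans (le_abs_self _)

theorem integrable_schwartz_mul_inner_sq (ψ : 𝓢(E, ℂ)) (V : Lp ℂ 2 (volume : Measure E)) (c₀ : ℝ)
    (m : E) : Integrable fun x => ψ x * (c₀ * (inner ℝ x m : ℝ) ^ 2 * V x) := by
  have hi : (fun x : E => Complex.ofReal (c₀ * inner ℝ x m ^ 2)).HasTemperateGrowth := by fun_prop
  refine (((SchwartzMap.smulLeftCLM ℂ (fun x : E => Complex.ofReal (c₀ * inner ℝ x m ^ 2)) ψ).memLp 2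
    volume).integrable_mul (Lp.memLp V)).congr (Filter.Eventually.of_forall fun x => ?_)
  simp only [Pi.mul_apply, SchwartzMap.smulLeftCLM_apply_apply hi, smul_eq_mul]
  push_cast
  ring

/-- `∂ⱼ (c ∂ⱼ v)` tested against the Fourier transform of a Schwartz function. -/
theorem lineDeriv_dualityProduct_fourier (c₀ : ℝ) {c₁ : Lp ℂ 2 (volume : Measure E)}
    (hc₁ : MemSobolev 1 2 (c₁ : 𝓢'(E, ℂ))) {v : 𝓢'(E, ℂ)} {V : Lp ℂ 2 (volume : Measure E)}
    (hv : 𝓕 v = (V : 𝓢'(E, ℂ))) {m : E} (hm : ‖m‖ = 1) (ψ : 𝓢(E, ℂ)) :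
    (∂_{m} (dualityProduct (coeffDistribution c₀ c₁) (∂_{m} v)) : 𝓢'(E, ℂ)) (𝓕 ψ) =
      -(4 * Real.pi ^ 2) * ((∫ x, ψ x * (c₀ * (inner ℝ x m : ℝ) ^ 2 * V x)) +
        ∫ z : E × E, ψ z.1 * ((𝓕 c₁ : Lp ℂ 2 (volume : Measure E)) (z.1 - z.2) *
          ((inner ℝ z.1 m * inner ℝ z.2 m : ℝ) : ℂ) * V z.2) ∂(volume.prod volume)) := by
  set k : Lp ℂ 2 (volume : Measure E) := 𝓕 c₁ with hk
  have hi : (fun x : E => ((inner ℝ x m : ℝ) : ℂ)).HasTemperateGrowth := by fun_prop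
  set ψ' : 𝓢(E, ℂ) := (2 * Real.pi * Complex.I) •
    SchwartzMap.smulLeftCLM ℂ (fun x : E => ((inner ℝ x m : ℝ) : ℂ)) ψ with hψ'
  have hψe : ∀ x, ψ' x = 2 * Real.pi * Complex.I * ((inner ℝ x m : ℝ) * ψ x) := fun x => by
    rw [hψ', smul_apply, SchwartzMap.smulLeftCLM_apply_apply hi, smul_eq_mul, smul_eq_mul]
  have h1 : (∂_{m} (dualityProduct (coeffDistribution c₀ c₁) (∂_{m} v)) : 𝓢'(E, ℂ)) (𝓕 ψ) =
      dualityProduct (coeffDistribution c₀ c₁) (∂_{m} v) (𝓕 ψ') := by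
    change dualityProduct (coeffDistribution c₀ c₁) (∂_{m} v) (-∂_{m} (𝓕 ψ : 𝓢(E, ℂ))) = _
    -- `-∂_m` of `𝓕 ψ` is the transform of `2πi (x·m) ψ`.
    congr 1
    rw [SchwartzMap.lineDerivOp_fourier_eq, neg_smul, FourierTransform.fourier_neg, neg_neg, hψ']
    have h : (inner ℝ · m : E → ℝ).HasTemperateGrowth := by fun_prop
    exact congrArg (fun χ : 𝓢(E, ℂ) => 𝓕 ((2 * Real.pi * Complex.I) • χ))
      (SchwartzMap.smulLeftCLM_ofReal ℂ h ψ).symm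
  have hk2 : l2Norm volume (fun x => ENNReal.ofReal (bracket x) * ‖k x‖ₑ) ≠ ∞ := by
    have := (memSobolev_iff_l2Norm_ne_top (Lp.fourier_toTemperedDistribution_eq c₁)).1 hc₁
    simpa only [Real.rpow_one] using this
  have hV2 := (l2Norm_lp_lt_top V).ne
  have hΦ := integrable_schwartz_kernel ψ (measurable_lp k) (measurable_lp V) hk2 hV2
    (B := fun x y => inner ℝ x m * inner ℝ y m) (by fun_prop) (fun x y => by
      rw [abs_mul]
      have := abs_real_inner_le_norm x m
      have := abs_real_inner_le_norm y m
      rw [hm, mul_one] at *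
      gcongr)
  have hψV := integrable_schwartz_mul_inner_sq ψ V c₀ m
  rw [h1, dualityProduct_lineDeriv_fourier c₀ hc₁ hv, mul_add, ← integral_const_mul,
    integral_prod_symm _ hΦ, ← integral_const_mul, ← integral_add (hψV.const_mul _)
      (hΦ.integral_prod_right.const_mul _)]
  refine integral_congr_ae (Filter.Eventually.of_forall fun y => ?_)
  have h2 : ∫ x, ψ' x * k (x - y) = 2 * Real.pi * Complex.I *
      ∫ x, (inner ℝ x m : ℝ) * ψ x * k (x - y) := by
    rw [← integral_const_mul]
    refine integral_congr_ae (Filter.Eventually.of_forall fun x => ?_)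
    simp only [hψe]
    ring
  have h3 : ∫ x, ψ x * (k (x - y) * ((inner ℝ x m * inner ℝ y m : ℝ) : ℂ) * V y) =
      (∫ x, (inner ℝ x m : ℝ) * ψ x * k (x - y)) * ((inner ℝ y m : ℝ) * V y) := by
    rw [← integral_mul_const]
    refine integral_congr_ae (Filter.Eventually.of_forall fun x => ?_)
    push_cast
    ring
  simp only
  rw [← hk, h2, h3, hψe]
  -- The two derivatives contribute a factor `2πi` each, hence `-4π²`.
  have := Complex.I_sq
  linear_combination (4 * Real.pi ^ 2 * (inner ℝ y m : ℝ) * V y * (c₀ * ((inner ℝ y m : ℝ) * ψ y) +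
    ∫ x, (inner ℝ x m : ℝ) * ψ x * k (x - y))) * this

/-- The equation `div (c grad v) = F` on the Fourier side. -/
theorem ae_equation_of_fourier_div_grad {ι : Type*} [Fintype ι] (b : OrthonormalBasis ι ℝ E) (c₀ : ℝ)
    {c₁ V F : Lp ℂ 2 (volume : Measure E)} (hc₁ : MemSobolev 1 2 (c₁ : 𝓢'(E, ℂ)))
    {v : 𝓢'(E, ℂ)} (hv : 𝓕 v = (V : 𝓢'(E, ℂ)))
    (hF : 𝓕 (∑ j, ∂_{b j} (dualityProduct (coeffDistribution c₀ c₁) (∂_{b j} v))) =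
      (F : 𝓢'(E, ℂ))) :
    ∀ᵐ x, c₀ * ‖x‖ ^ 2 * V x + ∫ y, (𝓕 c₁ : Lp ℂ 2 (volume : Measure E)) (x - y) *
      inner ℝ x y * V y = -(4 * Real.pi ^ 2 : ℂ)⁻¹ * F x := by
  set k : Lp ℂ 2 (volume : Measure E) := 𝓕 c₁ with hk
  have hk2 : l2Norm volume (fun x => ENNReal.ofReal (bracket x) * ‖k x‖ₑ) ≠ ∞ := by
    have := (memSobolev_iff_l2Norm_ne_top (Lp.fourier_toTemperedDistribution_eq c₁)).1 hc₁
    simpa only [Real.rpow_one] using this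
  have hV2 := (l2Norm_lp_lt_top V).ne
  have hkm := measurable_lp k
  have hVm := measurable_lp V
  have hF' : LocallyIntegrable fun x => -(4 * Real.pi ^ 2 : ℂ)⁻¹ * F x :=
    locallyIntegrable_continuous_mul_lp continuous_const F
  have hV' : LocallyIntegrable fun x => (c₀ * ‖x‖ ^ 2 : ℂ) * V x :=
    locallyIntegrable_continuous_mul_lp (by fun_prop) V
  refine ae_eq_of_forall_schwartz_integral_eq
    (hV'.add (locallyIntegrable_kernel hkm hVm hk2 hV2)) hF' fun ψ => ?_
  have hΦ : ∀ j, Integrable (fun z : E × E => ψ z.1 * (k (z.1 - z.2) *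
      ((inner ℝ z.1 (b j) * inner ℝ z.2 (b j) : ℝ) : ℂ) * V z.2)) (volume.prod volume) := fun j =>
    integrable_schwartz_kernel ψ hkm hVm hk2 hV2
    (B := fun x y => inner ℝ x (b j) * inner ℝ y (b j)) (by fun_prop) (fun x y => by
      rw [abs_mul]
      have h1 := abs_real_inner_le_norm x (b j)
      have h2 := abs_real_inner_le_norm y (b j)
      rw [b.orthonormal.1 j, mul_one] at h1 h2
      gcongr)
  have hΦ' : Integrable (fun z : E × E => ψ z.1 * (k (z.1 - z.2) *
      ((inner ℝ z.1 z.2 : ℝ) : ℂ) * V z.2)) (volume.prod volume) :=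
    integrable_schwartz_kernel ψ hkm hVm hk2 hV2 (by fun_prop) abs_real_inner_le_norm
  have h1 := congrArg (fun T : 𝓢'(E, ℂ) => T ψ) hF
  simp only [TemperedDistribution.fourier_apply, sum_apply, Lp.toTemperedDistribution_apply,
    smul_eq_mul, lineDeriv_dualityProduct_fourier c₀ hc₁ hv (b.orthonormal.1 _)] at h1
  -- Summing over the basis turns `(x·b_j)²` into `|x|²` here, and `(x·b_j)(y·b_j)` into `x·y` in
  -- `hB`.
  have hA : ∑ j, ∫ x, ψ x * (c₀ * (inner ℝ x (b j) : ℝ) ^ 2 * V x) =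
      ∫ x, ψ x * ((c₀ * ‖x‖ ^ 2 : ℂ) * V x) := by
    rw [← integral_finsetSum _ fun j _ => integrable_schwartz_mul_inner_sq ψ V c₀ (b j)]
    refine integral_congr_ae (Filter.Eventually.of_forall fun x => ?_)
    have := congrArg Complex.ofReal (b.sum_sq_inner_left x)
    push_cast at this
    simp only
    rw [← this, ← Finset.mul_sum, ← Finset.sum_mul, ← Finset.mul_sum]
  have hB : ∑ j, ∫ z : E × E, ψ z.1 * (k (z.1 - z.2) *
      ((inner ℝ z.1 (b j) * inner ℝ z.2 (b j) : ℝ) : ℂ) * V z.2) ∂(volume.prod volume) =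
      ∫ x, ψ x * ∫ y, k (x - y) * (inner ℝ x y : ℝ) * V y := by
    rw [← integral_finsetSum _ fun j _ => hΦ j]
    have e : ∀ z : E × E, ∑ j, ψ z.1 * (k (z.1 - z.2) *
        ((inner ℝ z.1 (b j) * inner ℝ z.2 (b j) : ℝ) : ℂ) * V z.2) =
        ψ z.1 * (k (z.1 - z.2) * ((inner ℝ z.1 z.2 : ℝ) : ℂ) * V z.2) := fun z => by
      rw [← Finset.mul_sum, ← Finset.sum_mul, ← Finset.mul_sum, ← Complex.ofReal_sum,
        ← b.sum_inner_mul_inner z.1 z.2]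
      simp only [real_inner_comm]
    simp only [e]
    rw [integral_prod _ hΦ']
    simp only [integral_const_mul]
  have hiB : Integrable fun x => ψ x * ∫ y, k (x - y) * (inner ℝ x y : ℝ) * V y := by
    simpa only [integral_const_mul] using hΦ'.integral_prod_left
  have hiA : Integrable fun x => ψ x * ((c₀ * ‖x‖ ^ 2 : ℂ) * V x) := by
    refine (integrable_finsetSum Finset.univ fun j _ =>
      integrable_schwartz_mul_inner_sq ψ V c₀ (b j)).congr (Filter.Eventually.of_forall fun x => ?_)
    have := congrArg Complex.ofReal (b.sum_sq_inner_left x)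
    push_cast at this
    simp only
    rw [← this, ← Finset.mul_sum, ← Finset.sum_mul, ← Finset.mul_sum]
  rw [← Finset.mul_sum, Finset.sum_add_distrib, hA, hB] at h1
  have h2 : ∫ x, ψ x * (-(4 * Real.pi ^ 2 : ℂ)⁻¹ * F x) =
      -(4 * Real.pi ^ 2 : ℂ)⁻¹ * ∫ x, ψ x * F x := by
    rw [← integral_const_mul]
    refine integral_congr_ae (Filter.Eventually.of_forall fun x => ?_)
    simp only
    ring
  simp only [mul_add]
  rw [integral_add hiA hiB, h2, ← h1]
  rw [← mul_assoc, neg_mul_neg, inv_mul_cancel₀ (by simp), one_mul]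

end Equation

/-! ### Iteration of the gain. -/

section Regularity

variable {E : Type*} [NormedAddCommGroup E] [InnerProductSpace ℝ E] [FiniteDimensional ℝ E]
  [MeasurableSpace E] [BorelSpace E]

theorem l2Norm_bracket_rpow_neg_ne_top {β : ℝ} (hβ : Module.finrank ℝ E < 2 * β) :
    l2Norm volume (fun x : E => ENNReal.ofReal (bracket x ^ (-β))) ≠ ∞ := by
  refine ENNReal.rpow_ne_top_of_nonneg (by norm_num) ?_
  have h := (integrable_rpow_neg_one_add_norm_sq (E := E) (μ := volume) hβ).lintegral_lt_top
  refine ne_of_lt (lt_of_eq_of_lt (lintegral_congr fun x => ?_) h)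
  have hb := bracket_pos x
  rw [← ENNReal.ofReal_pow (by positivity), ← bracket_rpow, ← Real.rpow_natCast, ← Real.rpow_mul hb.le]
  congr 2
  push_cast
  ring

/-- The Sobolev embedding into bounded functions, seen on the Fourier side: Cauchy-Schwarz against
the square integrable weight `⟨x⟩^(-t)`. -/
theorem lintegral_enorm_ne_top_of_l2Norm_bracket {t : ℝ} (ht : Module.finrank ℝ E < 2 * t) {k : E → ℂ}
    (hk : Measurable k)
    (h : l2Norm volume (fun x => ENNReal.ofReal (bracket x ^ t) * ‖k x‖ₑ) ≠ ∞) :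
    ∫⁻ x, ‖k x‖ₑ ≠ ∞ := by
  have hm : ∀ t : ℝ, Measurable fun x : E => ENNReal.ofReal (bracket x ^ t) := fun t =>
    ENNReal.measurable_ofReal.comp (continuous_bracket_rpow t).measurable
  have h1 := l2Norm_bracket_rpow_neg_ne_top ht
  have h2 := lintegral_mul_le_l2Norm (ν := (volume : Measure E)) (hm (-t)) ((hm t).mul hk.enorm)
  refine ne_top_of_le_ne_top (by finiteness) (le_trans (le_of_eq (lintegral_congr fun x => ?_)) h2)
  have hb := bracket_pos x
  rw [Pi.mul_apply, ← mul_assoc, ← ENNReal.ofReal_mul (by positivity), ← Real.rpow_add hb]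
  simp

/-- Elliptic regularity for `v ↦ div (c grad v)` with `c = c₀ + c₁`, in dimension at most two. -/
theorem memSobolev_add_two_of_div_grad (hE : Module.finrank ℝ E ≤ 2) {ι : Type*} [Fintype ι]
    (b : OrthonormalBasis ι ℝ E) {c₀ r s : ℝ} (hc₀ : 0 < c₀) (hs : 0 ≤ s) (hsr : s < r) (hr : r < 1)
    {u : Lp ℂ 2 (volume : Measure E)} {c : E → ℝ} (hc : ∀ᵐ x, 0 ≤ c x) (hu : ∀ᵐ x, u x = c x)
    (hu' : MemSobolev (r + 1) 2 (u : 𝓢'(E, ℂ))) {v : 𝓢'(E, ℂ)} (hv : MemSobolev s 2 v)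
    (hAv : MemSobolev s 2 (∑ j, ∂_{b j} (dualityProduct (coeffDistribution c₀ u) (∂_{b j} v)))) :
    MemSobolev (s + 2) 2 v := by
  obtain ⟨V, hV⟩ := memSobolev_zero_iff_exists_fourier.1 (hv.mono hs)
  obtain ⟨F, hF⟩ := memSobolev_zero_iff_exists_fourier.1 (hAv.mono hs)
  have heq := ae_equation_of_fourier_div_grad b c₀ (hu'.mono (by linarith)) hV hF
  have hF2 := (memSobolev_iff_l2Norm_ne_top hF).1 hAv
  set k : Lp ℂ 2 (volume : Measure E) := 𝓕 u with hk
  have hk2 := (memSobolev_iff_l2Norm_ne_top (Lp.fourier_toTemperedDistribution_eq u)).1 hu'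
  have hfr : (Module.finrank ℝ E : ℝ) ≤ 2 := by exact_mod_cast hE
  have hk1 := lintegral_enorm_ne_top_of_l2Norm_bracket (by linarith) (measurable_lp k) hk2
  -- `N > 2/r` makes `α = 2/N < r`, and `N` gains of `α` add up to exactly two derivatives.
  obtain ⟨N, hN⟩ := exists_nat_gt (2 / r)
  have hr0 : 0 < r := by linarith
  have hN0 : (0 : ℝ) < N := (by positivity : (0 : ℝ) < 2 / r).trans hN
  set α : ℝ := 2 / N with hα
  have hα0 : 0 < α := by positivity
  have hαr : α < r := by
    rw [hα, div_lt_iff₀ hN0]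
    rw [div_lt_iff₀ hr0] at hN
    linarith
  have hNα : N * α = 2 := by rw [hα]; field_simp
  have hF' : l2Norm volume (fun x => ENNReal.ofReal (bracket x ^ s) *
      ‖-(4 * Real.pi ^ 2 : ℂ)⁻¹ * F x‖ₑ) ≠ ∞ := by
    have : (fun x => ENNReal.ofReal (bracket x ^ s) * ‖-(4 * Real.pi ^ 2 : ℂ)⁻¹ * F x‖ₑ) =
        fun x => ‖-(4 * Real.pi ^ 2 : ℂ)⁻¹‖ₑ * (ENNReal.ofReal (bracket x ^ s) * ‖F x‖ₑ) := by
      funext x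
      rw [enorm_mul]
      ring
    rw [this, l2Norm_const_mul enorm_ne_top]
    finiteness
  have step : ∀ n : ℕ, n ≤ N →
      l2Norm volume (fun x => ENNReal.ofReal (bracket x ^ (s + n * α)) * ‖V x‖ₑ) ≠ ∞ := by
    intro n
    induction n with
    | zero => intro _; simpa using (memSobolev_iff_l2Norm_ne_top hV).1 hv
    | succ n ih =>
      intro hn
      have hnN : ((n : ℝ) + 1) * α ≤ 2 := by
        rw [← hNα]
        gcongr
        exact_mod_cast hn
      have hnα : 0 ≤ n * α := by positivity
      -- `p + 1 = s + nα` is the regularity reached so far. `β = 1 + r - α` gives `α + β = r + 1`,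
      -- the regularity of `c₁`, and exceeds 1 because `α < r`. The conditions `p ≤ β` and `p + α -
      -- 1 ≤ s` both follow from `(n + 1)α ≤ 2`, the former with `s < r`.
      have := l2Norm_bracket_ne_top_of_equation (measurable_lp k) (measurable_lp V)
        ((measurable_lp F).const_mul (-(4 * Real.pi ^ 2 : ℂ)⁻¹)) (p := s + n * α - 1) (α := α)
        (β := 1 + r - α) (s := s) hc₀ hα0.le (by linarith) (by linarith) (by linarith) (by linarith)
        (l2Norm_bracket_rpow_neg_ne_top (by linarith)) 
        (by rw [show α + (1 + r - α) = r + 1 by ring]; exact hk2) hk1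
        (fun h hm h2 => integral_conj_mul_kernel_nonneg u hc hu hk1 hm h2)
        (by simpa using ih (by omega)) hF' heq
      rw [show s + n * α - 1 + 1 + α = s + (n + 1 : ℕ) * α by push_cast; ring] at this
      exact this
  have := step N le_rfl
  rw [hNα] at this
  exact (memSobolev_iff_l2Norm_ne_top hV).2 this

end Regularity

theorem mainTheorem1 (c₀ r s : ℝ) (hc₀ : 0 < c₀) (hs : 0 ≤ s) (hsr : s < r) (hr : r < 1)
    (c₁ : EuclideanSpace ℝ (Fin 2) → ℝ) (hc₁_nonneg : ∀ᵐ x, 0 ≤ c₁ x)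
    (hc₁_L2 : MemLp (fun x => (c₁ x : ℂ)) 2 volume)
    (hc₁ : MemSobolev (r + 1) 2 (Lp.toTemperedDistribution (hc₁_L2.toLp (fun x => (c₁ x : ℂ)))))
    (v : 𝓢'(EuclideanSpace ℝ (Fin 2), ℂ)) (hv : MemSobolev s 2 v)
    (hAv : MemSobolev s 2
      (divGrad (coeffDistribution c₀ (hc₁_L2.toLp (fun x => (c₁ x : ℂ)))) v)) :
    MemSobolev (s + 2) 2 v := by
  refine memSobolev_add_two_of_div_grad (by simp) (EuclideanSpace.basisFun (Fin 2) ℝ) hc₀ hs hsr hr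
    hc₁_nonneg hc₁_L2.coeFn_toLp hc₁ hv ?_
  rw [divGrad] at hAv
  simpa only [EuclideanSpace.basisFun_apply] using hAv
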